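/- Let $\Omega=(0,1)^2$, $D_1=(0,\tfrac12)\times(0,1)$, $D_2=(\tfrac12,1)\times(0,1)$, $\Gamma=\{\tfrac12\}\times(0,1)$, and let $\kappa=\kappa^-$ in $D_1$ and $\kappa=1$ in $D_2$, where $\kappa^-\ge 1$ is a constant. Let $u$ be a solution of $$-\nabla\cdot(\kappa\nabla u)+u=f \ \text{ in } D_1\cup D_2,\qquad u=0\ \text{ on }\partial\Omega,\qquad [u]=\Big[\kappa\,\frac{\partial u}{\partial x}\Big]=0\ \text{ on }\Gamma,$$ where $[\zeta]$ denotes the difference of the left and right limits of $\zeta$ across $\Gamma$, and assume that $u|_{\overline{D}_i}\in C^6(\overline{D}_i)$ for $i=1,2$. For an integer $M\ge1$ put $N=2M+1$, $h=1/N$, $(x_i,y_j)=(ih,jh)$ for $0\le i,j\le N$. Let $\kappa^*>0$ be a number independent of $h$ (the averaged value of $\kappa$ used in the mesh cells cut by the interface). Let $(u_{i,j})_{0\le i,j\le N}$ solve the five-point "$\times$"-stencil MACH-like scheme: $u_{i,j}=0$ if $i\in\{0,N\}$ or $j\in\{0,N\}$, and for $1\le i,j\le N-1$ $$-\tfrac12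 k_i^{\rm l}\,(u_{i-1,j-1}+u_{i-1,j+1})-\tfrac12 k_i^{\rm r}\,(u_{i+1,j-1}+u_{i+1,j+1})+(k_i^{\rm l}+k_i^{\rm r}+h^2)\,u_{i,j}=h^2 f(x_i,y_j),$$ where $(k_i^{\rm l},k_i^{\rm r})=(\kappa^-,\kappa^-)$ for $i\le M-1$, $(\kappa^-,\kappa^*)$ for $i=M$, $(\kappa^*,1)$ for $i=M+1$, and $(1,1)$ for $i\ge M+2$. Let $\|\vec e\|_\infty=\max_{0\le i,j\le N}|u(x_i,y_j)-u_{i,j}|$. Then there is a constant $C$, independent of $h$ (it may depend on $u$, $\kappa^-$ and $\kappa^*$), such that for all $M\ge1$ $$\|\vec e\|_\infty\le C\,h\,|\ln h| .$$ If moreover Assumption I holds, that is, $\kappa^*=\dfrac{2\kappa^-}{\kappa^-+1}$ and $\lim_{x\to\frac12^-}\dfrac{\partial^2u}{\partial y^2}(x,y)=\lim_{x\to\frac12^+}\dfrac{\partial^2u}{\partial y^2}(x,y)=0$ for all $y\in(0,1)$, then there is a constant $C$, independent of $h$, such that for all $M\ge1$ $$\|\vec e\|_\infty\le C\,h^2\,|\ln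 h| .$$ -/

import Mathlib

open Set Filter Topology

namespace MachScheme

/-- The unit square `Ω = (0,1) × (0,1)`. -/
def Omega : Set (ℝ × ℝ) := Ioo 0 1 ×ˢ Ioo 0 1

/-- The left subdomain `D₁ = (0,1/2) × (0,1)`. -/
def D1 : Set (ℝ × ℝ) := Ioo 0 (1 / 2) ×ˢ Ioo 0 1

/-- The right subdomain `D₂ = (1/2,1) × (0,1)`. -/
def D2 : Set (ℝ × ℝ) := Ioo (1 / 2) 1 ×ˢ Ioo 0 1

/-- The diffusion coefficient: `κ⁻` in `D₁` and `1` in `D₂`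
(its value on the interface `x = 1/2` itself is never used). -/
noncomputable def kappa (κm : ℝ) (p : ℝ × ℝ) : ℝ := if p.1 < 1 / 2 then κm else 1

/-- The partial derivative with respect to `x`. -/
noncomputable def pdx (v : ℝ × ℝ → ℝ) (p : ℝ × ℝ) : ℝ := deriv (fun s => v (s, p.2)) p.1

/-- The partial derivative with respect to `y`. -/
noncomputable def pdy (v : ℝ × ℝ → ℝ) (p : ℝ × ℝ) : ℝ := deriv (fun t => v (p.1, t)) p.2

/-- The space `W` of functions on the closed square whose restrictions to
`closure D₁` and `closure D₂` are of class `C⁶` up to the boundary. -/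
def MemW (w : ℝ × ℝ → ℝ) : Prop :=
  ContDiffOn ℝ 6 w (closure D1) ∧ ContDiffOn ℝ 6 w (closure D2)

/-- `[ζ] = 0` on the interface `Γ = {1/2} × (0,1)`: at every point of `Γ` the one-sided limits
of `ζ` in the normal direction exist and agree. -/
def NoJump (ζ : ℝ × ℝ → ℝ) : Prop :=
  ∀ y ∈ Ioo (0 : ℝ) 1, ∃ g : ℝ,
    Tendsto (fun x => ζ (x, y)) (𝓝[<] (1 / 2)) (𝓝 g) ∧
    Tendsto (fun x => ζ (x, y)) (𝓝[>] (1 / 2)) (𝓝 g)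

/-- `u` solves the interface problem `-∇·(κ∇u) + u = f` in `D₁ ∪ D₂`, `u = 0` on `∂Ω`,
`[u] = [κ ∂u/∂n] = 0` on `Γ`. -/
structure SolvesInterfaceProblem (κm : ℝ) (f u : ℝ × ℝ → ℝ) : Prop where
  pde : ∀ p ∈ D1 ∪ D2,
    -(pdx (fun q => kappa κm q * pdx u q) p + pdy (fun q => kappa κm q * pdy u q) p) + u p = f p
  boundary : ∀ p ∈ frontier Omega, u p = 0
  jump : NoJump u
  flux : NoJump (fun q => kappa κm q * pdx u q)

/-- Number of mesh intervals in each direction, `N = 2M + 1`. -/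
def meshN (M : ℕ) : ℕ := 2 * M + 1

/-- Mesh size `h = 1 / N`. -/
noncomputable def meshH (M : ℕ) : ℝ := 1 / (meshN M : ℝ)

/-- The grid node `X_{i,j} = (i h, j h)`. -/
noncomputable def node (M i j : ℕ) : ℝ × ℝ := ((i : ℝ) * meshH M, (j : ℝ) * meshH M)

/-- The coefficients `a₁ = a₄` of the two left neighbours, in a row of index `i`. -/
noncomputable def aLeft (κm κs : ℝ) (M i : ℕ) : ℝ :=
  if i < M then -(1 / 2) * κm
  else if i = M then -(1 / 2) * κm
  else if i = M + 1 then -(1 / 2) * κs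
  else -(1 / 2)

/-- The coefficients `a₂ = a₅` of the two right neighbours. -/
noncomputable def aRight (κm κs : ℝ) (M i : ℕ) : ℝ :=
  if i < M then -(1 / 2) * κm
  else if i = M then -(1 / 2) * κs
  else if i = M + 1 then -(1 / 2)
  else -(1 / 2)

/-- The central coefficient `a₃`. -/
noncomputable def aCenter (κm κs : ℝ) (M i : ℕ) : ℝ :=
  if i < M then 2 * κm + meshH M ^ 2
  else if i = M then κm + κs + meshH M ^ 2
  else if i = M + 1 then κs + 1 + meshH M ^ 2
  else 2 + meshH M ^ 2

/-- The difference operator `L_h` on the five-point `×`-stencil; it is only used at interior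
nodes, `1 ≤ i, j ≤ N - 1`. -/
noncomputable def Lh (κm κs : ℝ) (M : ℕ) (U : ℕ → ℕ → ℝ) (i j : ℕ) : ℝ :=
  aLeft κm κs M i * U (i - 1) (j - 1) + aRight κm κs M i * U (i + 1) (j - 1)
    + aCenter κm κs M i * U i j
    + aLeft κm κs M i * U (i - 1) (j + 1) + aRight κm κs M i * U (i + 1) (j + 1)

/-- The grid function `U`, restricted to the nodes `0 ≤ i, j ≤ N`, solves the five-point
MACH-like scheme. -/
structure SolvesScheme (κm κs : ℝ) (f : ℝ × ℝ → ℝ) (M : ℕ) (U : ℕ → ℕ → ℝ) : Prop where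
  interior : ∀ i j : ℕ, 1 ≤ i → i ≤ meshN M - 1 → 1 ≤ j → j ≤ meshN M - 1 →
    Lh κm κs M U i j = meshH M ^ 2 * f (node M i j)
  bdry_x : ∀ j : ℕ, j ≤ meshN M → U 0 j = 0 ∧ U (meshN M) j = 0
  bdry_y : ∀ i : ℕ, i ≤ meshN M → U i 0 = 0 ∧ U i (meshN M) = 0

/-- The error vector `e_{i,j} = u(x_i,y_j) - U_{i,j}`, `0 ≤ i, j ≤ N`. Its norm is the maximum
norm, which is Mathlib's norm on a finite product of copies of `ℝ`. -/
noncomputable def errorVec (u : ℝ × ℝ → ℝ) (M : ℕ) (U : ℕ → ℕ → ℝ) :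
    Fin (meshN M + 1) × Fin (meshN M + 1) → ℝ :=
  fun p => u (node M p.1 p.2) - U p.1 p.2

/-- Assumption I: harmonic averaging, and `∂²u/∂y²` tends to zero at the interface from both
sides. -/
structure AssumptionI (κm κs : ℝ) (u : ℝ × ℝ → ℝ) : Prop where
  harmonic : κs = 2 * κm / (κm + 1)
  left : ∀ y ∈ Ioo (0 : ℝ) 1,
    Tendsto (fun x => pdy (pdy u) (x, y)) (𝓝[<] (1 / 2)) (𝓝 0)
  right : ∀ y ∈ Ioo (0 : ℝ) 1,
    Tendsto (fun x => pdy (pdy u) (x, y)) (𝓝[>] (1 / 2)) (𝓝 0)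

end MachScheme

/-!
The error is bounded by the discrete maximum principle, once the leading part of the defect has
been removed by an explicit corrector. Write `τ` for the image of the nodal error under the
difference operator.

Away from the interface `τ = O(h⁴)`, because the `×`-stencil averages the second differences along
the two diagonals (`exists_cross_stencil_le`). On the two mesh lines next to the interface
`τ` is only `O(h)`, or `O(h²)` under Assumption I, but there its leading parts on the two lines are
opposite to each other: `τ = ∓ κ* hᵖ g(y) + O(hᵖ⁺¹)` with `p = 1`, respectively `p = 2`
(`exists_defect_near_le`). This uses the flux condition, and for `p = 2` also that harmonic
averaging cancels the terms of order `h` and that `∂²u/∂y²` vanishes on the interface. The density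
`g` is a multiple of a one-sided `∂u/∂x`, respectively of the jump of `∂²u/∂x²`; it is smooth and
vanishes at `y = 0` and `y = 1`, because `u` vanishes on the horizontal edges.

Such a dipole is generated, up to higher order, by a grid function of size `hᵖ` which is zero to
the left of the interface and jumps to `hᵖ g` across it (`corrector`). After subtracting it, the
defect is `O(hᵖ⁺¹)` next to the interface and `O(hᵖ⁺²)` elsewhere, and comparison with a
piecewise linear hat (`barrier`) bounds the remainder by `O(hᵖ)`; these steps are
`abs_le_of_abs_Lh_le` and `abs_le_of_dipole`. The error is therefore `O(hᵖ)`, and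
`|ln h| ≥ 1` because `h ≤ 1/3`.
-/

namespace MachScheme

/-! ### Taylor expansion along lines -/

/-- The derivative of `v` in the direction `d`, taken within `R`. On a closed rectangle this is
the continuous extension to the boundary of the interior directional derivative. -/
noncomputable def dirDeriv (R : Set (ℝ × ℝ)) (d : ℝ × ℝ) (v : ℝ × ℝ → ℝ) (p : ℝ × ℝ) : ℝ :=
  fderivWithin ℝ v R p d

theorem dirDeriv_contDiffOn {R : Set (ℝ × ℝ)} (hR : UniqueDiffOn ℝ R) {n : ℕ} {v : ℝ × ℝ → ℝ}
    (hv : ContDiffOn ℝ ((n + 1 : ℕ) : WithTop ℕ∞) v R) (d : ℝ × ℝ) :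
    ContDiffOn ℝ n (dirDeriv R d v) R :=
  (hv.fderivWithin hR (by norm_cast)).clm_apply contDiffOn_const

theorem dirDeriv_iterate_contDiffOn {R : Set (ℝ × ℝ)} (hR : UniqueDiffOn ℝ R) (d : ℝ × ℝ)
    (n k : ℕ) {v : ℝ × ℝ → ℝ} (hv : ContDiffOn ℝ ((n + k : ℕ) : WithTop ℕ∞) v R) :
    ContDiffOn ℝ n ((dirDeriv R d)^[k] v) R := by
  induction k generalizing v with
  | zero => simpa using hv
  | succ k ih => exact ih (dirDeriv_contDiffOn hR hv d)

theorem hasDerivWithinAt_dirDeriv {R : Set (ℝ × ℝ)} {v : ℝ × ℝ → ℝ}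
    (hv : DifferentiableOn ℝ v R) (p d : ℝ × ℝ) {I : Set ℝ} (hI : ∀ t ∈ I, p + t • d ∈ R)
    {t : ℝ} (ht : t ∈ I) :
    HasDerivWithinAt (fun s => v (p + s • d)) (dirDeriv R d v (p + t • d)) I t := by
  have h1 : HasDerivWithinAt (fun s : ℝ => p + s • d) d I t := by
    simpa using (((hasDerivAt_id t).smul_const d).const_add p).hasDerivWithinAt
  exact (hv _ (hI t ht)).hasFDerivWithinAt.comp_hasDerivWithinAt t h1 (fun s hs => hI s hs)

/-- Taylor's formula for a chain `φ 0, φ 1, …` of successive derivatives on a convex set of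
reals, expanded at `0` with a crude remainder. -/
theorem abs_sub_taylor_le {I : Set ℝ} (hI : Convex ℝ I) (h0 : (0 : ℝ) ∈ I) (n : ℕ)
    (φ : ℕ → ℝ → ℝ) (hφ : ∀ k < n, ∀ t ∈ I, HasDerivWithinAt (φ k) (φ (k + 1) t) I t)
    {K : ℝ} (hK : ∀ t ∈ I, |φ n t| ≤ K) {t : ℝ} (ht : t ∈ I) :
    |φ 0 t - ∑ k ∈ Finset.range n, t ^ k / (k.factorial : ℝ) * φ k 0| ≤ K * |t| ^ n := by
  induction n generalizing φ t with
  | zero => simpa using hK t ht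
  | succ n ih =>
    have hder : ∀ s ∈ I, HasDerivWithinAt
        (fun t => φ 0 t - ∑ k ∈ Finset.range (n + 1), t ^ k / (k.factorial : ℝ) * φ k 0)
        (φ 1 s - ∑ k ∈ Finset.range n, s ^ k / (k.factorial : ℝ) * φ (k + 1) 0) I s := by
      intro s hs
      refine (hφ 0 (Nat.succ_pos n) s hs).sub ?_
      have hsum : HasDerivAt
          (fun t => ∑ k ∈ Finset.range (n + 1), t ^ k / (k.factorial : ℝ) * φ k 0)
          (∑ k ∈ Finset.range (n + 1), (k : ℝ) * s ^ (k - 1) / (k.factorial : ℝ) * φ k 0) s :=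
        HasDerivAt.fun_sum fun k _ => ((hasDerivAt_pow k s).div_const _).mul_const _
      rw [Finset.sum_range_succ'] at hsum
      simp only [Nat.cast_zero, zero_mul, zero_div, add_zero, Nat.add_sub_cancel] at hsum
      convert hsum.hasDerivWithinAt using 1
      refine Finset.sum_congr rfl fun k _ => ?_
      rw [Nat.factorial_succ]
      have := Nat.factorial_ne_zero k
      push_cast
      field_simp
    have hsub : segment ℝ 0 t ⊆ I := hI.segment_subset h0 ht
    have habs : ∀ s ∈ segment ℝ 0 t, |s| ≤ |t| := by
      intro s hs
      rw [segment_eq_uIcc] at hs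
      simpa using abs_sub_left_of_mem_uIcc hs
    have hb := (convex_segment (𝕜 := ℝ) (0 : ℝ) t).norm_image_sub_le_of_norm_hasDerivWithin_le
      (C := K * |t| ^ n) (fun s hs => (hder s (hsub hs)).mono hsub)
      (fun s hs => by
        have hs' := ih (fun k => φ (k + 1)) (fun k hk => hφ (k + 1) (by omega)) hK (hsub hs)
        have hK0 : 0 ≤ K := (abs_nonneg _).trans (hK 0 h0)
        rw [Real.norm_eq_abs]
        refine hs'.trans ?_
        exact mul_le_mul_of_nonneg_left (pow_le_pow_left₀ (abs_nonneg _) (habs s hs) _) hK0)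
      (left_mem_segment ℝ 0 t) (right_mem_segment ℝ 0 t)
    have hz : ∑ k ∈ Finset.range (n + 1), (0 : ℝ) ^ k / (k.factorial : ℝ) * φ k 0 = φ 0 0 := by
      rw [Finset.sum_range_succ']
      simp
    rw [hz, sub_self, sub_zero, Real.norm_eq_abs, sub_zero, Real.norm_eq_abs] at hb
    rw [pow_succ, ← mul_assoc]
    exact hb

theorem exists_abs_le {R : Set (ℝ × ℝ)} (hc : IsCompact R) {v : ℝ × ℝ → ℝ}
    (hv : ContinuousOn v R) : ∃ K : ℝ, 0 ≤ K ∧ ∀ p ∈ R, |v p| ≤ K := by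
  obtain ⟨K, hK⟩ := hc.exists_bound_of_continuousOn hv
  exact ⟨max K 0, le_max_right _ _, fun p hp => (hK p hp).trans (le_max_left _ _)⟩

/-- Taylor's formula along lines in a compact convex set, with a remainder constant that is
uniform over the set. -/
theorem exists_taylor_line {R : Set (ℝ × ℝ)} (hR : UniqueDiffOn ℝ R) (hc : IsCompact R)
    (hconv : Convex ℝ R) (d : ℝ × ℝ) (n : ℕ) {v : ℝ × ℝ → ℝ} (hv : ContDiffOn ℝ n v R) :
    ∃ K : ℝ, 0 ≤ K ∧ ∀ p ∈ R, ∀ t : ℝ, p + t • d ∈ R →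
      |v (p + t • d) - ∑ k ∈ Finset.range n,
        t ^ k / (k.factorial : ℝ) * (dirDeriv R d)^[k] v p| ≤ K * |t| ^ n := by
  obtain ⟨K, hK0, hK⟩ := exists_abs_le hc
    (dirDeriv_iterate_contDiffOn hR d 0 n (by simpa using hv)).continuousOn
  refine ⟨K, hK0, fun p hp t ht => ?_⟩
  have hI : Convex ℝ {s : ℝ | p + s • d ∈ R} := by
    intro a ha b hb α β hα hβ hαβ
    have := hconv ha hb hα hβ hαβ
    have e : p + (α • a + β • b) • d = α • (p + a • d) + β • (p + b • d) := by
      have : p = α • p + β • p := by rw [← add_smul, hαβ, one_smul]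
      nth_rewrite 1 [this]
      simp only [smul_add, add_smul, smul_eq_mul, mul_smul]
      abel
    simpa only [mem_ofPred_eq, e] using this
  have := abs_sub_taylor_le hI (by simpa using hp) n
    (fun k s => (dirDeriv R d)^[k] v (p + s • d)) (fun k hk s hs => ?_)
    (fun s hs => hK _ hs) (t := t) ht
  · simpa using this
  · have hd : ContDiffOn ℝ ((1 : ℕ) : WithTop ℕ∞) ((dirDeriv R d)^[k] v) R :=
      dirDeriv_iterate_contDiffOn hR d 1 k (hv.of_le (by norm_cast; omega))
    have h1 := hasDerivWithinAt_dirDeriv (hd.differentiableOn (by norm_num)) p d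
      (I := {s : ℝ | p + s • d ∈ R}) (fun s hs => hs) hs
    simpa only [Function.iterate_succ_apply'] using h1

/-- The closed rectangle `[a,b] × [0,1]`. -/
def strip (a b : ℝ) : Set (ℝ × ℝ) := Icc a b ×ˢ Icc 0 1

theorem strip_compact (a b : ℝ) : IsCompact (strip a b) := isCompact_Icc.prod isCompact_Icc

theorem strip_convex (a b : ℝ) : Convex ℝ (strip a b) := (convex_Icc a b).prod (convex_Icc 0 1)

theorem strip_uniqueDiffOn {a b : ℝ} (h : a < b) : UniqueDiffOn ℝ (strip a b) :=
  (uniqueDiffOn_Icc h).prod (uniqueDiffOn_Icc one_pos)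

/-- The derivative in `x` on the closed rectangle `[a,b] × [0,1]`. -/
noncomputable abbrev dx (a b : ℝ) := dirDeriv (strip a b) (1, 0)

/-- The derivative in `y` on the closed rectangle `[a,b] × [0,1]`. -/
noncomputable abbrev dy (a b : ℝ) := dirDeriv (strip a b) (0, 1)

/-- The Laplacian on the closed rectangle `[a,b] × [0,1]`. -/
noncomputable def lap (a b : ℝ) (v : ℝ × ℝ → ℝ) (p : ℝ × ℝ) : ℝ :=
  dx a b (dx a b v) p + dy a b (dy a b v) p

/-! ### Finite differences on a closed rectangle -/

theorem exists_second_difference_le {R : Set (ℝ × ℝ)} (hR : UniqueDiffOn ℝ R) (hc : IsCompact R)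
    (hconv : Convex ℝ R) (d : ℝ × ℝ) {v : ℝ × ℝ → ℝ} (hv : ContDiffOn ℝ 2 v R) :
    ∃ K : ℝ, 0 ≤ K ∧ ∀ p ∈ R, ∀ t : ℝ, p + t • d ∈ R → p + (-t) • d ∈ R →
      |v (p + t • d) + v (p + (-t) • d) - 2 * v p| ≤ K * t ^ 2 := by
  obtain ⟨K, hK0, hK⟩ := exists_taylor_line hR hc hconv d 2 hv
  refine ⟨2 * K, by positivity, fun p hp t h1 h2 => ?_⟩
  have e1 := abs_le.1 (hK p hp t h1)
  have e2 := abs_le.1 (hK p hp (-t) h2)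
  simp [Finset.sum_range_succ] at e1 e2
  rw [abs_le, neg_smul]
  constructor <;> linarith

theorem exists_second_difference_sub_le {R : Set (ℝ × ℝ)} (hR : UniqueDiffOn ℝ R)
    (hc : IsCompact R) (hconv : Convex ℝ R) (d : ℝ × ℝ) {v : ℝ × ℝ → ℝ}
    (hv : ContDiffOn ℝ 4 v R) :
    ∃ K : ℝ, 0 ≤ K ∧ ∀ p ∈ R, ∀ t : ℝ, p + t • d ∈ R → p + (-t) • d ∈ R →
      |v (p + t • d) + v (p + (-t) • d) - 2 * v p
        - t ^ 2 * dirDeriv R d (dirDeriv R d v) p| ≤ K * t ^ 4 := by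
  obtain ⟨K, hK0, hK⟩ := exists_taylor_line hR hc hconv d 4 hv
  refine ⟨2 * K, by positivity, fun p hp t h1 h2 => ?_⟩
  have e1 := abs_le.1 (hK p hp t h1)
  have e2 := abs_le.1 (hK p hp (-t) h2)
  have h4 : |t| ^ 4 = t ^ 4 := (by decide : Even 4).pow_abs t
  have f2 : (Nat.factorial 2 : ℝ) = 2 := by norm_num [Nat.factorial]
  have f3 : (Nat.factorial 3 : ℝ) = 6 := by norm_num [Nat.factorial]
  rw [abs_neg, h4] at e2
  rw [h4] at e1
  simp only [Finset.sum_range_succ, Finset.sum_range_zero, Function.iterate_succ_apply',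
    Function.iterate_zero_apply, f2, f3, Nat.factorial_zero, Nat.factorial_one, Nat.cast_one]
    at e1 e2
  rw [abs_le]
  constructor <;> linarith

/-- The two diagonal second derivatives add up to twice the Laplacian: the mixed derivatives
cancel, whether or not they commute. -/
theorem dirDeriv_diagonals {a b : ℝ} (hab : a < b) {v : ℝ × ℝ → ℝ}
    (hv : ContDiffOn ℝ 2 v (strip a b)) {p : ℝ × ℝ} (hp : p ∈ strip a b) :
    dirDeriv (strip a b) (1, 1) (dirDeriv (strip a b) (1, 1) v) p
      + dirDeriv (strip a b) (1, -1) (dirDeriv (strip a b) (1, -1) v) p = 2 * lap a b v p := by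
  have hR := strip_uniqueDiffOn hab
  have e1 : ∀ w : ℝ × ℝ → ℝ, dirDeriv (strip a b) (1, 1) w
      = fun q => dx a b w q + dy a b w q := by
    intro w
    ext q
    simp only [dx, dy, dirDeriv, ← map_add]
    simp
  have e2 : ∀ w : ℝ × ℝ → ℝ, dirDeriv (strip a b) (1, -1) w
      = fun q => dx a b w q - dy a b w q := by
    intro w
    ext q
    simp only [dx, dy, dirDeriv, ← map_sub]
    simp
  have hx : DifferentiableWithinAt ℝ (dx a b v) (strip a b) p :=
    (dirDeriv_contDiffOn hR (n := 1) (by simpa using hv) _).differentiableOn (by norm_num) p hp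
  have hy : DifferentiableWithinAt ℝ (dy a b v) (strip a b) p :=
    (dirDeriv_contDiffOn hR (n := 1) (by simpa using hv) _).differentiableOn (by norm_num) p hp
  have hadd : ∀ d, dirDeriv (strip a b) d (fun q => dx a b v q + dy a b v q) p
      = dirDeriv (strip a b) d (dx a b v) p + dirDeriv (strip a b) d (dy a b v) p := by
    intro d
    change fderivWithin ℝ (fun q => dx a b v q + dy a b v q) (strip a b) p d = _
    rw [fderivWithin_fun_add (hR p hp) hx hy]
    rfl
  have hsub : ∀ d, dirDeriv (strip a b) d (fun q => dx a b v q - dy a b v q) p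
      = dirDeriv (strip a b) d (dx a b v) p - dirDeriv (strip a b) d (dy a b v) p := by
    intro d
    change fderivWithin ℝ (fun q => dx a b v q - dy a b v q) (strip a b) p d = _
    rw [fderivWithin_fun_sub (hR p hp) hx hy]
    rfl
  rw [e1 v, e2 v, hadd, hsub, e1, e1, e2, e2, lap]
  ring

/-- Fourth-order consistency of the `×`-stencil with twice the Laplacian, up to the boundary. -/
theorem exists_cross_stencil_le {a b : ℝ} (hab : a < b) {v : ℝ × ℝ → ℝ}
    (hv : ContDiffOn ℝ 4 v (strip a b)) :
    ∃ K : ℝ, 0 ≤ K ∧ ∀ x y h : ℝ, (x, y) ∈ strip a b → (x - h, y - h) ∈ strip a b →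
      (x + h, y + h) ∈ strip a b →
      |v (x + h, y + h) + v (x - h, y - h) + v (x + h, y - h) + v (x - h, y + h) - 4 * v (x, y)
        - 2 * h ^ 2 * lap a b v (x, y)| ≤ K * h ^ 4 := by
  have hR := strip_uniqueDiffOn hab
  obtain ⟨K₁, h₁, hK₁⟩ :=
    exists_second_difference_sub_le hR (strip_compact a b) (strip_convex a b) (1, 1) hv
  obtain ⟨K₂, h₂, hK₂⟩ :=
    exists_second_difference_sub_le hR (strip_compact a b) (strip_convex a b) (1, -1) hv
  refine ⟨K₁ + K₂, by positivity, fun x y h hp hm hq => ?_⟩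
  have hd := dirDeriv_diagonals hab (hv.of_le (by norm_num)) hp
  have s1 : ((x, y) : ℝ × ℝ) + h • ((1, 1) : ℝ × ℝ) = (x + h, y + h) := by simp
  have s2 : ((x, y) : ℝ × ℝ) + (-h) • ((1, 1) : ℝ × ℝ) = (x - h, y - h) := by
    simp [sub_eq_add_neg]
  have s3 : ((x, y) : ℝ × ℝ) + h • ((1, -1) : ℝ × ℝ) = (x + h, y - h) := by
    simp [sub_eq_add_neg]
  have s4 : ((x, y) : ℝ × ℝ) + (-h) • ((1, -1) : ℝ × ℝ) = (x - h, y + h) := by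
    simp [sub_eq_add_neg]
  have m3 : (x + h, y - h) ∈ strip a b := ⟨hq.1, hm.2⟩
  have m4 : (x - h, y + h) ∈ strip a b := ⟨hm.1, hq.2⟩
  have e1 := hK₁ (x, y) hp h (by rwa [s1]) (by rwa [s2])
  have e2 := hK₂ (x, y) hp h (by rwa [s3]) (by rwa [s4])
  rw [s1, s2] at e1
  rw [s3, s4] at e2
  have e := (abs_add_le _ _).trans (add_le_add e1 e2)
  rw [← add_mul] at e
  refine le_of_eq_of_le (congrArg abs ?_) e
  linear_combination h ^ 2 * hd

/-- Expansion of `v` about the vertical line `x = c`: the value at distance `s` from the line,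
the average of the two values at heights `y ± h`, and the Laplacian. -/
theorem exists_interface_expansion {a b c : ℝ} (hab : a < b) (hc : c ∈ Icc a b)
    {v : ℝ × ℝ → ℝ} (hv : ContDiffOn ℝ 4 v (strip a b)) :
    ∃ K : ℝ, 0 ≤ K ∧ ∀ y h s : ℝ, 0 ≤ h → |s| ≤ 2 * h → c + s ∈ Icc a b → y ∈ Icc (0 : ℝ) 1 →
      y - h ∈ Icc (0 : ℝ) 1 → y + h ∈ Icc (0 : ℝ) 1 →
      |v (c + s, y) - (v (c, y) + s * dx a b v (c, y)
          + s ^ 2 / 2 * dx a b (dx a b v) (c, y))| ≤ K * h ^ 3 ∧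
      |(v (c + s, y - h) + v (c + s, y + h)) / 2 - (v (c, y) + s * dx a b v (c, y)
          + s ^ 2 / 2 * dx a b (dx a b v) (c, y)
          + h ^ 2 / 2 * dy a b (dy a b v) (c, y))| ≤ K * h ^ 3 ∧
      |lap a b v (c + s, y) - lap a b v (c, y)| ≤ K * h := by
  have hR := strip_uniqueDiffOn hab
  have hcp := strip_compact a b
  have hcv := strip_convex a b
  have hxx := dirDeriv_iterate_contDiffOn hR (1, 0) 2 2 (by norm_num; exact hv)
  have hyy := dirDeriv_iterate_contDiffOn hR (0, 1) 2 2 (by norm_num; exact hv)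
  obtain ⟨K₁, h₁, hK₁⟩ := exists_taylor_line hR hcp hcv (1, 0) 3
    (hv.of_le (by norm_num) : ContDiffOn ℝ ((3 : ℕ) : WithTop ℕ∞) v _)
  obtain ⟨K₂, h₂, hK₂⟩ := exists_taylor_line hR hcp hcv (0, 1) 3
    (hv.of_le (by norm_num) : ContDiffOn ℝ ((3 : ℕ) : WithTop ℕ∞) v _)
  obtain ⟨K₃, h₃, hK₃⟩ := exists_taylor_line hR hcp hcv (1, 0) 1 (hxx.of_le (by norm_num))
  obtain ⟨K₄, h₄, hK₄⟩ := exists_taylor_line hR hcp hcv (1, 0) 1 (hyy.of_le (by norm_num))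
  refine ⟨8 * K₁ + K₂ + 2 * K₃ + 2 * K₄, by positivity, fun y h s hh hs hcs hy hym hyp => ?_⟩
  have sx : ∀ y : ℝ, ((c, y) : ℝ × ℝ) + s • ((1, 0) : ℝ × ℝ) = (c + s, y) := by simp
  have sy : ∀ t : ℝ, ((c + s, y) : ℝ × ℝ) + t • ((0, 1) : ℝ × ℝ) = (c + s, y + t) := by simp
  have m0 : (c, y) ∈ strip a b := ⟨hc, hy⟩
  have m1 : (c + s, y) ∈ strip a b := ⟨hcs, hy⟩
  have hs3 : |s| ^ 3 ≤ 8 * h ^ 3 := by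
    calc |s| ^ 3 ≤ (2 * h) ^ 3 := pow_le_pow_left₀ (abs_nonneg s) hs 3
      _ = 8 * h ^ 3 := by ring
  have h3 : 0 ≤ h ^ 3 := by positivity
  have f2 : (Nat.factorial 2 : ℝ) = 2 := by norm_num [Nat.factorial]
  have e1 := hK₁ (c, y) m0 s (by rw [sx]; exact m1)
  have e2 := hK₂ (c + s, y) m1 h (by rw [sy]; exact ⟨hcs, hyp⟩)
  have e3 := hK₂ (c + s, y) m1 (-h) (by rw [sy]; exact ⟨hcs, by simpa [sub_eq_add_neg] using hym⟩)
  have e4 := hK₃ (c, y) m0 s (by rw [sx]; exact m1)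
  have e5 := hK₄ (c, y) m0 s (by rw [sx]; exact m1)
  rw [abs_neg] at e3
  rw [abs_of_nonneg hh] at e2 e3
  simp only [sx, sy, Finset.sum_range_succ, Finset.sum_range_zero, Function.iterate_succ_apply',
    Function.iterate_zero_apply, f2, Nat.factorial_zero, Nat.factorial_one, Nat.cast_one,
    ← sub_eq_add_neg, pow_zero, pow_one, div_one, one_mul, zero_add] at e1 e2 e3 e4 e5
  have e1' : |v (c + s, y) - (v (c, y) + s * dx a b v (c, y)
      + s ^ 2 / 2 * dx a b (dx a b v) (c, y))| ≤ 8 * K₁ * h ^ 3 :=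
    e1.trans (by nlinarith)
  have e4' := e4.trans (mul_le_mul_of_nonneg_left hs h₃)
  have e5' := e5.trans (mul_le_mul_of_nonneg_left hs h₄)
  have g2 : 0 ≤ K₂ * h ^ 3 := by positivity
  have g3 : 0 ≤ K₃ * h ^ 3 := by positivity
  have g4 : 0 ≤ K₄ * h ^ 3 := by positivity
  have g1 : 0 ≤ K₁ * h ^ 3 := by positivity
  refine ⟨e1'.trans (by linarith), ?_, ?_⟩
  · have e6 : |h ^ 2 / 2 * (dy a b (dy a b v) (c + s, y) - dy a b (dy a b v) (c, y))|
        ≤ K₄ * h ^ 3 := by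
      rw [abs_mul, abs_of_nonneg (by positivity)]
      calc _ ≤ h ^ 2 / 2 * (K₄ * (2 * h)) := by gcongr
        _ = K₄ * h ^ 3 := by ring
    rw [abs_le] at *
    constructor <;> linarith
  · have g1 : 0 ≤ K₁ * h := by positivity
    have g2 : 0 ≤ K₂ * h := by positivity
    simp only [lap]
    rw [abs_le] at *
    constructor <;> linarith

/-! ### Stability of the discrete operator -/

theorem meshN_pos (M : ℕ) : (0 : ℝ) < meshN M := by
  unfold meshN; positivity

theorem meshH_pos (M : ℕ) : 0 < meshH M := one_div_pos.2 (meshN_pos M)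

theorem meshN_mul_meshH (M : ℕ) : (meshN M : ℝ) * meshH M = 1 :=
  mul_one_div_cancel (meshN_pos M).ne'

theorem mul_meshH (M : ℕ) : (M : ℝ) * meshH M = 1 / 2 - meshH M / 2 := by
  have := meshN_mul_meshH M
  simp only [meshN] at this
  push_cast at this
  linarith

theorem meshH_le_third {M : ℕ} (hM : 1 ≤ M) : meshH M ≤ 1 / 3 := by
  have h1 := mul_meshH M
  have h2 : (1 : ℝ) ≤ M := by exact_mod_cast hM
  nlinarith [meshH_pos M]

theorem one_le_abs_log_meshH {M : ℕ} (hM : 1 ≤ M) : 1 ≤ |Real.log (meshH M)| := by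
  have h0 := meshH_pos M
  have h1 := meshH_le_third hM
  have h2 : Real.log (meshH M) ≤ -1 := by
    rw [Real.log_le_iff_le_exp h0]
    refine h1.trans ?_
    rw [Real.exp_neg, one_div]
    exact inv_anti₀ (Real.exp_pos 1) (Real.exp_one_lt_d9.le.trans (by norm_num))
  rw [abs_of_neg (by linarith)]
  linarith

section Coefficients
variable {κm κs : ℝ} {M i : ℕ}

theorem aCenter_eq (κm κs : ℝ) (M i : ℕ) :
    aCenter κm κs M i = -2 * aLeft κm κs M i - 2 * aRight κm κs M i + meshH M ^ 2 := by
  unfold aCenter aLeft aRight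
  split_ifs <;> ring

theorem aLeft_neg (hκm : 0 < κm) (hκs : 0 < κs) : aLeft κm κs M i < 0 := by
  unfold aLeft; split_ifs <;> linarith

theorem aRight_neg (hκm : 0 < κm) (hκs : 0 < κs) : aRight κm κs M i < 0 := by
  unfold aRight; split_ifs <;> linarith

theorem Lh_sub (U V : ℕ → ℕ → ℝ) (i j : ℕ) :
    Lh κm κs M (fun i j => U i j - V i j) i j = Lh κm κs M U i j - Lh κm κs M V i j := by
  simp only [Lh]; ring

theorem Lh_of_lt (U : ℕ → ℕ → ℝ) {i : ℕ} (j : ℕ) (hi : i < M) :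
    Lh κm κs M U i j = -(κm / 2) * (U (i + 1) (j + 1) + U (i - 1) (j - 1) + U (i + 1) (j - 1)
      + U (i - 1) (j + 1) - 4 * U i j) + meshH M ^ 2 * U i j := by
  simp only [Lh, aLeft, aRight, aCenter, if_pos hi]; ring

theorem Lh_left (U : ℕ → ℕ → ℝ) (j : ℕ) :
    Lh κm κs M U M j = -κm * ((U (M - 1) (j - 1) + U (M - 1) (j + 1)) / 2 - U M j)
      - κs * ((U (M + 1) (j - 1) + U (M + 1) (j + 1)) / 2 - U M j) + meshH M ^ 2 * U M j := by
  simp only [Lh, aLeft, aRight, aCenter, lt_irrefl, if_false, if_true]; ring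

theorem Lh_right (U : ℕ → ℕ → ℝ) (j : ℕ) :
    Lh κm κs M U (M + 1) j = -κs * ((U M (j - 1) + U M (j + 1)) / 2 - U (M + 1) j)
      - ((U (M + 2) (j - 1) + U (M + 2) (j + 1)) / 2 - U (M + 1) j)
      + meshH M ^ 2 * U (M + 1) j := by
  have h1 : ¬ M + 1 < M := by omega
  have h2 : M + 1 ≠ M := by omega
  simp only [Lh, aLeft, aRight, aCenter, if_neg h1, if_neg h2, if_true, Nat.add_sub_cancel]; ring

theorem Lh_of_gt (U : ℕ → ℕ → ℝ) {i : ℕ} (j : ℕ) (hi : M + 1 < i) :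
    Lh κm κs M U i j = -(1 / 2) * (U (i + 1) (j + 1) + U (i - 1) (j - 1) + U (i + 1) (j - 1)
      + U (i - 1) (j + 1) - 4 * U i j) + meshH M ^ 2 * U i j := by
  have h1 : ¬ i < M := by omega
  have h2 : i ≠ M := by omega
  have h3 : i ≠ M + 1 := by omega
  simp only [Lh, aLeft, aRight, aCenter, if_neg h1, if_neg h2, if_neg h3]; ring

/-- The discrete maximum principle: the matrix of the scheme is a strictly diagonally dominant
M-matrix. -/
theorem nonneg_of_Lh_nonneg (hκm : 0 < κm) (hκs : 0 < κs) {V : ℕ → ℕ → ℝ}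
    (hL : ∀ i j : ℕ, 1 ≤ i → i ≤ meshN M - 1 → 1 ≤ j → j ≤ meshN M - 1 → 0 ≤ Lh κm κs M V i j)
    (hb : ∀ i j : ℕ, i ≤ meshN M → j ≤ meshN M →
      (i = 0 ∨ i = meshN M ∨ j = 0 ∨ j = meshN M) → 0 ≤ V i j)
    {i j : ℕ} (hi : i ≤ meshN M) (hj : j ≤ meshN M) : 0 ≤ V i j := by
  by_contra hneg
  obtain ⟨⟨k, l⟩, hmem, hmin⟩ := Finset.exists_min_image
    (Finset.range (meshN M + 1) ×ˢ Finset.range (meshN M + 1)) (fun q => V q.1 q.2)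
    ⟨(i, j), by simp; omega⟩
  have hmin' : ∀ i j : ℕ, i ≤ meshN M → j ≤ meshN M → V k l ≤ V i j := fun i j hi hj =>
    hmin (i, j) (by simp; omega)
  simp only [Finset.mem_product, Finset.mem_range] at hmem
  have hkl : V k l < 0 := (hmin' i j hi hj).trans_lt (not_le.1 hneg)
  have hint : ¬ (k = 0 ∨ k = meshN M ∨ l = 0 ∨ l = meshN M) := fun h =>
    absurd (hb k l (by omega) (by omega) h) (not_le.2 hkl)
  push Not at hint
  have h := hL k l (by omega) (by omega) (by omega) (by omega)
  have ha := aLeft_neg (M := M) (i := k) hκm hκs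
  have hr := aRight_neg (M := M) (i := k) hκm hκs
  have hh : 0 < meshH M ^ 2 := pow_pos (meshH_pos M) 2
  -- at a negative interior minimum the row is at most `h ^ 2 * V k l < 0`
  rw [Lh, aCenter_eq] at h
  have t1 := mul_le_mul_of_nonpos_left (hmin' (k - 1) (l - 1) (by omega) (by omega)) ha.le
  have t2 := mul_le_mul_of_nonpos_left (hmin' (k - 1) (l + 1) (by omega) (by omega)) ha.le
  have t3 := mul_le_mul_of_nonpos_left (hmin' (k + 1) (l - 1) (by omega) (by omega)) hr.le
  have t4 := mul_le_mul_of_nonpos_left (hmin' (k + 1) (l + 1) (by omega) (by omega)) hr.le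
  have t5 := mul_neg_of_pos_of_neg hh hkl
  linarith

/-- The barrier: a hat in `x` whose discrete flux is `h` to the left of the interface, `0` across
it and `-h` to the right, so that the scheme maps it to at least `h` on the two mesh lines next to
the interface. -/
noncomputable def barrier (κm : ℝ) (M i : ℕ) : ℝ :=
  if i ≤ M then 2 + (i : ℝ) * meshH M / κm
  else 2 + (M : ℝ) * meshH M / κm - ((i : ℝ) - M - 1) * meshH M

theorem barrier_bounds (hκm : 1 ≤ κm) (hi : i ≤ meshN M) :
    1 ≤ barrier κm M i ∧ barrier κm M i ≤ 3 := by
  have hh := meshH_pos M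
  have hm := mul_meshH M
  have hN := meshN_mul_meshH M
  have hdiv : ∀ k : ℕ, k ≤ M → 0 ≤ (k : ℝ) * meshH M / κm ∧ (k : ℝ) * meshH M / κm ≤ 1 := by
    intro k hk
    have hk' : (k : ℝ) ≤ M := by exact_mod_cast hk
    refine ⟨by positivity, (div_le_self (by positivity) hκm).trans ?_⟩
    nlinarith
  unfold barrier
  split_ifs with h
  · constructor <;> linarith [hdiv i h]
  · have h1 : (M : ℝ) + 1 ≤ i := by exact_mod_cast (by omega : M + 1 ≤ i)
    have h2 : (i : ℝ) * meshH M ≤ 1 := by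
      rw [← hN]
      gcongr
    have h3 : 0 ≤ ((i : ℝ) - M - 1) * meshH M := mul_nonneg (by linarith) hh.le
    have h4 : ((i : ℝ) - M - 1) * meshH M ≤ 1 := by nlinarith
    constructor <;> linarith [hdiv M le_rfl]

theorem le_Lh_barrier (hκm : 1 ≤ κm) (hM : 1 ≤ M) {i : ℕ} (j : ℕ) (h1 : 1 ≤ i)
    (h2 : i ≤ meshN M - 1) :
    (if i = M ∨ i = M + 1 then meshH M else meshH M ^ 2)
      ≤ Lh κm κs M (fun i _ => barrier κm M i) i j := by
  have hb := (barrier_bounds hκm (show i ≤ meshN M by omega)).1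
  have hh : 0 < meshH M ^ 2 := pow_pos (meshH_pos M) 2
  have hhb : meshH M ^ 2 ≤ meshH M ^ 2 * barrier κm M i := le_mul_of_one_le_right hh.le hb
  have hκ : κm ≠ 0 := by linarith
  have hcast : ((i - 1 : ℕ) : ℝ) = i - 1 := by push_cast [Nat.cast_sub h1]; ring
  rcases lt_trichotomy i M with h | h | h
  · rw [Lh_of_lt _ _ h, if_neg (by omega)]
    have e1 : barrier κm M (i + 1) + barrier κm M (i - 1) = 2 * barrier κm M i := by
      rw [barrier, barrier, barrier, if_pos (by omega), if_pos (by omega), if_pos (by omega), hcast]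
      push_cast; ring
    linear_combination hhb + κm * e1
  · subst h
    rw [Lh_left, if_pos (by simp)]
    have e1 : κm * (barrier κm i i - barrier κm i (i - 1)) = meshH i := by
      rw [barrier, barrier, if_pos (by omega), if_pos (by omega), hcast]
      field_simp; ring
    have e2 : barrier κm i (i + 1) = barrier κm i i := by
      rw [barrier, barrier, if_neg (by omega), if_pos (by omega)]
      push_cast; ring
    simp only [e2]
    linarith
  · rcases eq_or_lt_of_le (Nat.succ_le_of_lt h) with h' | h'
    · subst h'
      rw [Nat.succ_eq_add_one, Lh_right, if_pos (by simp)]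
      have e1 : barrier κm M (M + 1) - barrier κm M (M + 2) = meshH M := by
        rw [barrier, barrier, if_neg (by omega), if_neg (by omega)]
        push_cast; ring
      have e2 : barrier κm M (M + 1) = barrier κm M M := by
        rw [barrier, barrier, if_neg (by omega), if_pos (by omega)]
        push_cast; ring
      rw [Nat.succ_eq_add_one] at hhb
      rw [← e2]
      linarith
    · rw [Lh_of_gt _ _ h', if_neg (by omega)]
      have e1 : barrier κm M (i + 1) + barrier κm M (i - 1) = 2 * barrier κm M i := by
        rw [barrier, barrier, barrier, if_neg (by omega), if_neg (by omega), if_neg (by omega),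
          hcast]
        push_cast; ring
      linear_combination hhb + e1

/-- Stability: defects of size `Q h²`, and of size `Q h` on the two mesh lines next to the
interface, produce a grid function of size at most `3 Q`. -/
theorem abs_le_of_abs_Lh_le (hκm : 1 ≤ κm) (hκs : 0 < κs) (hM : 1 ≤ M) {V : ℕ → ℕ → ℝ} {Q : ℝ}
    (hQ : 0 ≤ Q)
    (hL : ∀ i j : ℕ, 1 ≤ i → i ≤ meshN M - 1 → 1 ≤ j → j ≤ meshN M - 1 →
      |Lh κm κs M V i j| ≤ Q * (if i = M ∨ i = M + 1 then meshH M else meshH M ^ 2))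
    (hb : ∀ i j : ℕ, i ≤ meshN M → j ≤ meshN M →
      (i = 0 ∨ i = meshN M ∨ j = 0 ∨ j = meshN M) → V i j = 0)
    {i j : ℕ} (hi : i ≤ meshN M) (hj : j ≤ meshN M) : |V i j| ≤ 3 * Q := by
  have key : ∀ s : ℝ, |s| = 1 → 0 ≤ Q * barrier κm M i - s * V i j := by
    intro s hs
    refine nonneg_of_Lh_nonneg (M := M) (V := fun i j => Q * barrier κm M i - s * V i j)
      (by linarith : 0 < κm) hκs (fun i j h1 h2 h3 h4 => ?_) (fun i j h1 h2 h3 => ?_) hi hj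
    · have e : Lh κm κs M (fun i j => Q * barrier κm M i - s * V i j) i j
          = Q * Lh κm κs M (fun i _ => barrier κm M i) i j - s * Lh κm κs M V i j := by
        simp only [Lh]; ring
      have hV : s * Lh κm κs M V i j ≤ |Lh κm κs M V i j| := by
        refine (le_abs_self _).trans ?_
        rw [abs_mul, hs, one_mul]
      rw [e]
      have := mul_le_mul_of_nonneg_left (le_Lh_barrier (κs := κs) hκm hM j h1 h2) hQ
      linarith [hL i j h1 h2 h3 h4]
    · simp only [hb i j h1 h2 h3, mul_zero, sub_zero]
      exact mul_nonneg hQ (by linarith [(barrier_bounds hκm h1).1])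
  have hB := mul_le_mul_of_nonneg_left (barrier_bounds hκm hi).2 hQ
  have k1 := key 1 (by simp)
  have k2 := key (-1) (by simp)
  rw [abs_le]
  constructor <;> linarith

/-- The corrector: it vanishes up to the interface, jumps to `G` across it and decays linearly
to zero at the right boundary. Under the scheme it produces a dipole of strength `κ* G` on the two
mesh lines next to the interface. -/
noncomputable def corrector (M : ℕ) (G : ℕ → ℝ) (i j : ℕ) : ℝ :=
  if i ≤ M then 0 else ((meshN M : ℝ) - i) / M * G j

theorem corrector_of_le {G : ℕ → ℝ} (h : i ≤ M) (j : ℕ) : corrector M G i j = 0 := if_pos h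

theorem corrector_of_lt {G : ℕ → ℝ} (h : M < i) (j : ℕ) :
    corrector M G i j = ((meshN M : ℝ) - i) / M * G j := if_neg (not_le.2 h)

theorem corrector_weight (hM : 1 ≤ M) (h1 : M < i) (h2 : i ≤ meshN M) :
    0 ≤ ((meshN M : ℝ) - i) / M ∧ ((meshN M : ℝ) - i) / M ≤ 1 := by
  have hM' : (0 : ℝ) < M := by exact_mod_cast hM
  have h2' : (i : ℝ) ≤ meshN M := by exact_mod_cast h2
  have h1' : (M : ℝ) + 1 ≤ i := by exact_mod_cast h1
  refine ⟨div_nonneg (by linarith) hM'.le, (div_le_one hM').2 ?_⟩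
  simp only [meshN]
  push_cast
  linarith

theorem abs_corrector_le (hM : 1 ≤ M) {G : ℕ → ℝ} {Q : ℝ} (hQ : 0 ≤ Q) {i j : ℕ}
    (hi : i ≤ meshN M) (hG : |G j| ≤ Q) : |corrector M G i j| ≤ Q := by
  unfold corrector
  split_ifs with h
  · simpa using hQ
  · obtain ⟨h1, h2⟩ := corrector_weight hM (not_le.1 h) hi
    rw [abs_mul, abs_of_nonneg h1]
    exact (mul_le_of_le_one_left (abs_nonneg _) h2).trans hG

/-- A dipole in the defect is harmless: if the defect of `E` on the two mesh lines next to the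
interface is `∓ κ* G` up to `O(Q h)`, with `G` of size `Q`, twice differentiable in the discrete
sense and zero at both ends, then `E` is of size `Q`. -/
theorem abs_le_of_dipole (hκm : 1 ≤ κm) (hκs : 0 < κs) (hM : 1 ≤ M) {E : ℕ → ℕ → ℝ} {G : ℕ → ℝ}
    {Q : ℝ} (hQ : 0 ≤ Q)
    (hb : ∀ i j : ℕ, i ≤ meshN M → j ≤ meshN M →
      (i = 0 ∨ i = meshN M ∨ j = 0 ∨ j = meshN M) → E i j = 0)
    (hG : ∀ j ≤ meshN M, |G j| ≤ Q) (hG0 : G 0 = 0) (hGN : G (meshN M) = 0)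
    (hG2 : ∀ j, 1 ≤ j → j ≤ meshN M - 1 →
      |G (j - 1) + G (j + 1) - 2 * G j| ≤ Q * meshH M ^ 2)
    (hfar : ∀ i j : ℕ, 1 ≤ i → i ≤ meshN M - 1 → 1 ≤ j → j ≤ meshN M - 1 → i ≠ M → i ≠ M + 1 →
      |Lh κm κs M E i j| ≤ Q * meshH M ^ 2)
    (hleft : ∀ j : ℕ, 1 ≤ j → j ≤ meshN M - 1 → |Lh κm κs M E M j + κs * G j| ≤ Q * meshH M)
    (hright : ∀ j : ℕ, 1 ≤ j → j ≤ meshN M - 1 →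
      |Lh κm κs M E (M + 1) j - κs * G j| ≤ Q * meshH M)
    {i j : ℕ} (hi : i ≤ meshN M) (hj : j ≤ meshN M) : |E i j| ≤ (3 * (κs + 6) + 1) * Q := by
  have hh := meshH_pos M
  have hh3 := meshH_le_third hM
  have hM' : (0 : ℝ) < M := by exact_mod_cast hM
  have hNM : (meshN M : ℝ) = 2 * M + 1 := by simp [meshN]
  have hMh := mul_meshH M
  have hV : |E i j - corrector M G i j| ≤ 3 * ((κs + 6) * Q) := by
    refine abs_le_of_abs_Lh_le hκm hκs hM (V := fun i j => E i j - corrector M G i j)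
      (by positivity) (fun i j h1 h2 h3 h4 => ?_) (fun i j h1 h2 h3 => ?_) hi hj
    · rw [Lh_sub]
      have hGj := hG j (by omega)
      have hG2j := hG2 j h3 h4
      have hQh : 0 ≤ Q * meshH M := by positivity
      have hQh2 : 0 ≤ Q * meshH M ^ 2 := by positivity
      have hsq : meshH M ^ 2 ≤ meshH M := by nlinarith
      have hQhh : Q * meshH M ^ 2 ≤ Q * meshH M := mul_le_mul_of_nonneg_left hsq hQ
      have hκQ : 0 ≤ κs * (Q * meshH M) := by positivity
      have hκQ2 : 0 ≤ κs * (Q * meshH M ^ 2) := by positivity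
      rcases lt_trichotomy i M with h | h | h
      · have hz : Lh κm κs M (corrector M G) i j = 0 := by
          rw [Lh_of_lt _ _ h]
          simp only [corrector_of_le (show i + 1 ≤ M by omega),
            corrector_of_le (show i - 1 ≤ M by omega), corrector_of_le h.le]
          ring
        rw [hz, sub_zero, if_neg (by omega)]
        have := hfar i j h1 h2 h3 h4 (by omega) (by omega)
        linarith
      · subst h
        -- only the two right neighbours see the corrector
        have hz : Lh κm κs i (corrector i G) i j
            = -κs * G j - κs / 2 * (G (j - 1) + G (j + 1) - 2 * G j) := by
          rw [Lh_left]
          simp only [corrector_of_le (show i - 1 ≤ i by omega), corrector_of_le le_rfl,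
            corrector_of_lt (Nat.lt_succ_self i), hNM]
          push_cast
          field_simp
          ring
        rw [hz, if_pos (by simp)]
        have e : |κs / 2 * (G (j - 1) + G (j + 1) - 2 * G j)| ≤ κs * (Q * meshH i) := by
          rw [abs_mul, abs_of_nonneg (by positivity)]
          calc _ ≤ κs / 2 * (Q * meshH i) := by gcongr; linarith
            _ ≤ κs * (Q * meshH i) := by linarith
        have := hleft j h3 h4
        rw [abs_le] at *
        constructor <;> linarith
      · rcases eq_or_lt_of_le (Nat.succ_le_of_lt h) with h' | h'
        · subst h'
          rw [Nat.succ_eq_add_one] at *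
          have hz : Lh κm κs M (corrector M G) (M + 1) j = κs * G j
              + (-(1 / 2) * (1 - 1 / M) * (G (j - 1) + G (j + 1) - 2 * G j)
                + (1 / M + meshH M ^ 2) * G j) := by
            rw [Lh_right]
            simp only [corrector_of_le le_rfl, corrector_of_lt (Nat.lt_succ_self M),
              corrector_of_lt (show M < M + 2 by omega), hNM]
            push_cast
            field_simp
            ring
          rw [hz, if_pos (by simp)]
          have hinv : 1 / (M : ℝ) ≤ 3 * meshH M := by
            rw [div_le_iff₀ hM']
            nlinarith
          have hinv1 : 1 / (M : ℝ) ≤ 1 := by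
            rw [div_le_one hM']
            exact_mod_cast hM
          have hinv0 : 0 ≤ 1 / (M : ℝ) := by positivity
          have e1 : |-(1 / 2) * (1 - 1 / (M : ℝ)) * (G (j - 1) + G (j + 1) - 2 * G j)|
              ≤ Q * meshH M := by
            rw [abs_mul]
            have : |-(1 / 2) * (1 - 1 / (M : ℝ))| ≤ 1 := by
              rw [abs_le]; constructor <;> linarith
            exact (mul_le_of_le_one_left (abs_nonneg _) this).trans (hG2j.trans hQhh)
          have e2 : |(1 / (M : ℝ) + meshH M ^ 2) * G j| ≤ 4 * (Q * meshH M) := by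
            rw [abs_mul, abs_of_nonneg (by positivity)]
            calc _ ≤ (4 * meshH M) * Q := by gcongr; linarith
              _ = _ := by ring
          have := hright j h3 h4
          rw [abs_le] at *
          constructor <;> linarith
        · have hcast : ((i - 1 : ℕ) : ℝ) = i - 1 := by push_cast [Nat.cast_sub h1]; ring
          have hz : Lh κm κs M (corrector M G) i j
              = ((meshN M : ℝ) - i) / M
                * (-(G (j - 1) + G (j + 1) - 2 * G j) + meshH M ^ 2 * G j) := by
            rw [Lh_of_gt _ _ h']
            simp only [corrector_of_lt (show M < i + 1 by omega),
              corrector_of_lt (show M < i - 1 by omega), corrector_of_lt h, hcast]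
            push_cast
            field_simp
            ring
          rw [hz, if_neg (by omega)]
          obtain ⟨w0, w1⟩ := corrector_weight hM h (by omega : i ≤ meshN M)
          have e1 : |-(G (j - 1) + G (j + 1) - 2 * G j) + meshH M ^ 2 * G j|
              ≤ 2 * (Q * meshH M ^ 2) := by
            refine (abs_add_le _ _).trans ?_
            rw [abs_neg, abs_mul, abs_of_nonneg (by positivity : 0 ≤ meshH M ^ 2)]
            nlinarith [mul_le_mul_of_nonneg_left hGj (sq_nonneg (meshH M))]
          have e2 : |((meshN M : ℝ) - i) / M
              * (-(G (j - 1) + G (j + 1) - 2 * G j) + meshH M ^ 2 * G j)|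
              ≤ 2 * (Q * meshH M ^ 2) := by
            rw [abs_mul, abs_of_nonneg w0]
            exact (mul_le_of_le_one_left (abs_nonneg _) w1).trans e1
          have := hfar i j h1 h2 h3 h4 (by omega) (by omega)
          refine (abs_sub _ _).trans ?_
          linarith
    · simp only [hb i j h1 h2 h3, zero_sub, neg_eq_zero, corrector]
      split_ifs with h
      · rfl
      · rcases h3 with h3 | h3 | h3 | h3
        · omega
        · rw [h3]; simp
        · rw [h3, hG0, mul_zero]
        · rw [h3, hGN, mul_zero]
  have hW := abs_corrector_le hM hQ hi (hG j hj)
  rw [abs_le] at *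
  constructor <;> linarith

end Coefficients

/-! ### The interface problem in terms of one-sided traces -/

section Traces
variable {a b : ℝ} {v : ℝ × ℝ → ℝ} {x y : ℝ}

theorem hasDerivWithinAt_dx (hv : DifferentiableOn ℝ v (strip a b)) (hx : x ∈ Icc a b)
    (hy : y ∈ Icc (0 : ℝ) 1) :
    HasDerivWithinAt (fun s => v (s, y)) (dx a b v (x, y)) (Icc a b) x := by
  have h : HasDerivWithinAt (fun s : ℝ => (s, y)) ((1 : ℝ), (0 : ℝ)) (Icc a b) x :=
    ((hasDerivAt_id x).prodMk (hasDerivAt_const x y)).hasDerivWithinAt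
  have hm : MapsTo (fun s : ℝ => (s, y)) (Icc a b) (strip a b) := fun _ hs => ⟨hs, hy⟩
  exact (hv (x, y) ⟨hx, hy⟩).hasFDerivWithinAt.comp_hasDerivWithinAt x h hm

theorem hasDerivWithinAt_dy (hv : DifferentiableOn ℝ v (strip a b)) (hx : x ∈ Icc a b)
    (hy : y ∈ Icc (0 : ℝ) 1) :
    HasDerivWithinAt (fun t => v (x, t)) (dy a b v (x, y)) (Icc 0 1) y := by
  have h : HasDerivWithinAt (fun t : ℝ => (x, t)) ((0 : ℝ), (1 : ℝ)) (Icc 0 1) y :=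
    ((hasDerivAt_const y x).prodMk (hasDerivAt_id y)).hasDerivWithinAt
  have hm : MapsTo (fun t : ℝ => (x, t)) (Icc 0 1) (strip a b) := fun _ ht => ⟨hx, ht⟩
  exact (hv (x, y) ⟨hx, hy⟩).hasFDerivWithinAt.comp_hasDerivWithinAt y h hm

theorem hasDerivAt_dx (hv : DifferentiableOn ℝ v (strip a b)) (hx : x ∈ Ioo a b)
    (hy : y ∈ Ioo (0 : ℝ) 1) : HasDerivAt (fun s => v (s, y)) (dx a b v (x, y)) x :=
  (hasDerivWithinAt_dx hv (Ioo_subset_Icc_self hx) (Ioo_subset_Icc_self hy)).hasDerivAt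
    (Icc_mem_nhds hx.1 hx.2)

theorem hasDerivAt_dy (hv : DifferentiableOn ℝ v (strip a b)) (hx : x ∈ Ioo a b)
    (hy : y ∈ Ioo (0 : ℝ) 1) : HasDerivAt (fun t => v (x, t)) (dy a b v (x, y)) y :=
  (hasDerivWithinAt_dy hv (Ioo_subset_Icc_self hx) (Ioo_subset_Icc_self hy)).hasDerivAt
    (Icc_mem_nhds hy.1 hy.2)

theorem pdy_pdy_eq (hv : DifferentiableOn ℝ v (strip a b))
    (hv' : DifferentiableOn ℝ (dy a b v) (strip a b)) (hx : x ∈ Ioo a b) (hy : y ∈ Ioo (0 : ℝ) 1) :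
    pdy (pdy v) (x, y) = dy a b (dy a b v) (x, y) := by
  have e : (fun t => pdy v (x, t)) =ᶠ[𝓝 y] fun t => dy a b v (x, t) := by
    filter_upwards [Ioo_mem_nhds hy.1 hy.2] with t ht using (hasDerivAt_dy hv hx ht).deriv
  exact e.deriv_eq.trans (hasDerivAt_dy hv' hx hy).deriv

/-- Where the coefficient is constant, the divergence-form operator is a multiple of the
Laplacian. -/
theorem divergence_eq {κm k : ℝ} (hab : a < b) (hv : ContDiffOn ℝ 2 v (strip a b))
    (hk : ∀ s ∈ Ioo a b, ∀ t, kappa κm (s, t) = k) (hx : x ∈ Ioo a b) (hy : y ∈ Ioo (0 : ℝ) 1) :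
    pdx (fun q => kappa κm q * pdx v q) (x, y) + pdy (fun q => kappa κm q * pdy v q) (x, y)
      = k * lap a b v (x, y) := by
  have hR := strip_uniqueDiffOn hab
  have h0 : DifferentiableOn ℝ v (strip a b) := hv.differentiableOn (by norm_num)
  have h1 : ∀ d, DifferentiableOn ℝ (dirDeriv (strip a b) d v) (strip a b) := fun d =>
    (dirDeriv_contDiffOn hR (n := 1) (by simpa using hv) d).differentiableOn (by norm_num)
  have ex : (fun s => kappa κm (s, y) * pdx v (s, y)) =ᶠ[𝓝 x] fun s => k * dx a b v (s, y) := by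
    filter_upwards [Ioo_mem_nhds hx.1 hx.2] with s hs
    rw [hk s hs, ← (hasDerivAt_dx h0 hs hy).deriv]
    rfl
  have ey : (fun t => kappa κm (x, t) * pdy v (x, t)) =ᶠ[𝓝 y] fun t => k * dy a b v (x, t) := by
    filter_upwards [Ioo_mem_nhds hy.1 hy.2] with t ht
    rw [hk x hx, ← (hasDerivAt_dy h0 hx ht).deriv]
    rfl
  have hX : pdx (fun q => kappa κm q * pdx v q) (x, y) = k * dx a b (dx a b v) (x, y) :=
    ex.deriv_eq.trans ((hasDerivAt_dx (h1 _) hx hy).const_mul k).deriv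
  have hY : pdy (fun q => kappa κm q * pdy v q) (x, y) = k * dy a b (dy a b v) (x, y) :=
    ey.deriv_eq.trans ((hasDerivAt_dy (h1 _) hx hy).const_mul k).deriv
  rw [hX, hY, lap]
  ring

theorem tendsto_trace_left (hab : a < b) (hv : ContinuousOn v (strip a b))
    (hy : y ∈ Icc (0 : ℝ) 1) : Tendsto (fun x => v (x, y)) (𝓝[<] b) (𝓝 (v (b, y))) := by
  have hc : ContinuousOn (fun x => v (x, y)) (Icc a b) :=
    hv.comp (by fun_prop) (fun x hx => ⟨hx, hy⟩)
  rw [← nhdsWithin_Ioo_eq_nhdsLT hab]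
  exact (hc b (right_mem_Icc.2 hab.le)).mono_left (nhdsWithin_mono _ Ioo_subset_Icc_self)

theorem tendsto_trace_right (hab : a < b) (hv : ContinuousOn v (strip a b))
    (hy : y ∈ Icc (0 : ℝ) 1) : Tendsto (fun x => v (x, y)) (𝓝[>] a) (𝓝 (v (a, y))) := by
  have hc : ContinuousOn (fun x => v (x, y)) (Icc a b) :=
    hv.comp (by fun_prop) (fun x hx => ⟨hx, hy⟩)
  rw [← nhdsWithin_Ioo_eq_nhdsGT hab]
  exact (hc a (left_mem_Icc.2 hab.le)).mono_left (nhdsWithin_mono _ Ioo_subset_Icc_self)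

theorem dx_eq_zero_of_edge (hab : a < b) (hv : DifferentiableOn ℝ v (strip a b))
    (hy : y ∈ Icc (0 : ℝ) 1) (h0 : ∀ s ∈ Icc a b, v (s, y) = 0) (hx : x ∈ Icc a b) :
    dx a b v (x, y) = 0 :=
  (uniqueDiffOn_Icc hab x hx).eq_deriv _ (hasDerivWithinAt_dx hv hx hy)
    ((hasDerivWithinAt_const x (Icc a b) (0 : ℝ)).congr h0 (h0 x hx))

theorem exists_vertical_second_difference_le {c : ℝ} (hab : a < b) (hc : c ∈ Icc a b)
    (hv : ContDiffOn ℝ 2 v (strip a b)) :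
    ∃ K : ℝ, 0 ≤ K ∧ (∀ y ∈ Icc (0 : ℝ) 1, |v (c, y)| ≤ K) ∧
      ∀ y h : ℝ, y ∈ Icc (0 : ℝ) 1 → y - h ∈ Icc (0 : ℝ) 1 → y + h ∈ Icc (0 : ℝ) 1 →
        |v (c, y - h) + v (c, y + h) - 2 * v (c, y)| ≤ K * h ^ 2 := by
  obtain ⟨K₁, h₁, hK₁⟩ := exists_abs_le (strip_compact a b) hv.continuousOn
  obtain ⟨K₂, h₂, hK₂⟩ := exists_second_difference_le (strip_uniqueDiffOn hab)
    (strip_compact a b) (strip_convex a b) (0, 1) hv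
  refine ⟨K₁ + K₂, by positivity, fun y hy => (hK₁ _ ⟨hc, hy⟩).trans (by linarith),
    fun y h hy hm hp => ?_⟩
  have s : ∀ t : ℝ, ((c, y) : ℝ × ℝ) + t • ((0, 1) : ℝ × ℝ) = (c, y + t) := by simp
  have e := hK₂ (c, y) ⟨hc, hy⟩ h (by rw [s]; exact ⟨hc, hp⟩)
    (by rw [s]; exact ⟨hc, by simpa [sub_eq_add_neg] using hm⟩)
  rw [s, s, ← sub_eq_add_neg, add_comm (v _)] at e
  exact e.trans (mul_le_mul_of_nonneg_right (by linarith) (sq_nonneg h))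

end Traces

theorem closure_D1 : closure D1 = strip 0 (1 / 2) := by
  rw [D1, closure_prod_eq, closure_Ioo (by norm_num), closure_Ioo (by norm_num), strip]

theorem closure_D2 : closure D2 = strip (1 / 2) 1 := by
  rw [D2, closure_prod_eq, closure_Ioo (by norm_num), closure_Ioo (by norm_num), strip]

theorem mem_frontier_Omega {p : ℝ × ℝ} (h1 : p.1 ∈ Icc (0 : ℝ) 1) (h2 : p.2 ∈ Icc (0 : ℝ) 1)
    (h : p.1 = 0 ∨ p.1 = 1 ∨ p.2 = 0 ∨ p.2 = 1) : p ∈ frontier Omega := by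
  have ho : IsOpen Omega := isOpen_Ioo.prod isOpen_Ioo
  rw [ho.frontier_eq, Omega, closure_prod_eq, closure_Ioo (by norm_num)]
  refine ⟨⟨h1, h2⟩, fun ⟨⟨h3, h4⟩, h5, h6⟩ => ?_⟩
  rcases h with h | h | h | h <;> linarith

section Solution
variable {κm : ℝ} {f u : ℝ × ℝ → ℝ}

theorem source_left (hu : SolvesInterfaceProblem κm f u) (hW : MemW u) {x y : ℝ}
    (hx : x ∈ Ioo (0 : ℝ) (1 / 2)) (hy : y ∈ Ioo (0 : ℝ) 1) :
    f (x, y) = -(κm * lap 0 (1 / 2) u (x, y)) + u (x, y) := by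
  have h := hu.pde (x, y) (Or.inl ⟨hx, hy⟩)
  rw [divergence_eq (k := κm) one_half_pos ((closure_D1 ▸ hW.1).of_le (by norm_num))
    (fun s hs t => if_pos hs.2) hx hy] at h
  exact h.symm

/-- The factor `1` is the value of the coefficient, kept so that both sides of the interface have
the same form. -/
theorem source_right (hu : SolvesInterfaceProblem κm f u) (hW : MemW u) {x y : ℝ}
    (hx : x ∈ Ioo (1 / 2 : ℝ) 1) (hy : y ∈ Ioo (0 : ℝ) 1) :
    f (x, y) = -(1 * lap (1 / 2) 1 u (x, y)) + u (x, y) := by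
  have h := hu.pde (x, y) (Or.inr ⟨hx, hy⟩)
  rw [divergence_eq (k := 1) one_half_lt_one ((closure_D2 ▸ hW.2).of_le (by norm_num))
    (fun s hs t => if_neg (not_lt.2 hs.1.le)) hx hy] at h
  exact h.symm

/-- The flux condition as an identity between the one-sided traces of `∂u/∂x`. -/
theorem flux_eq (hu : SolvesInterfaceProblem κm f u) (hW : MemW u) {y : ℝ}
    (hy : y ∈ Ioo (0 : ℝ) 1) :
    dx (1 / 2) 1 u (1 / 2, y) = κm * dx 0 (1 / 2) u (1 / 2, y) := by
  have hy' := Ioo_subset_Icc_self hy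
  have v1 : ContDiffOn ℝ 6 u (strip 0 (1 / 2)) := closure_D1 ▸ hW.1
  have v2 : ContDiffOn ℝ 6 u (strip (1 / 2) 1) := closure_D2 ▸ hW.2
  have c1 := (dirDeriv_contDiffOn (strip_uniqueDiffOn one_half_pos) (n := 1)
    (v1.of_le (by norm_num)) (1, 0)).continuousOn
  have c2 := (dirDeriv_contDiffOn (strip_uniqueDiffOn one_half_lt_one) (n := 1)
    (v2.of_le (by norm_num)) (1, 0)).continuousOn
  obtain ⟨g, hl, hr⟩ := hu.flux y hy
  have e1 : (fun x => kappa κm (x, y) * pdx u (x, y)) =ᶠ[𝓝[<] (1 / 2)]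
      fun x => κm * dx 0 (1 / 2) u (x, y) := by
    filter_upwards [Ioo_mem_nhdsLT (one_half_pos : (0 : ℝ) < 1 / 2)] with x hx
    rw [kappa, if_pos hx.2, ← (hasDerivAt_dx (v1.differentiableOn (by norm_num)) hx hy).deriv]
    rfl
  have e2 : (fun x => kappa κm (x, y) * pdx u (x, y)) =ᶠ[𝓝[>] (1 / 2)]
      fun x => dx (1 / 2) 1 u (x, y) := by
    filter_upwards [Ioo_mem_nhdsGT (one_half_lt_one : (1 / 2 : ℝ) < 1)] with x hx
    rw [kappa, if_neg (not_lt.2 hx.1.le), one_mul,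
      ← (hasDerivAt_dx (v2.differentiableOn (by norm_num)) hx hy).deriv]
    rfl
  rw [← tendsto_nhds_unique (hl.congr' e1) ((tendsto_trace_left one_half_pos c1 hy').const_mul κm)]
  exact (tendsto_nhds_unique (hr.congr' e2) (tendsto_trace_right one_half_lt_one c2 hy')).symm

end Solution

/-- Error propagation through one row of the scheme: `P`, `R` are the averaged neighbours, `V` the
central value and `L` the Laplacian, each replaced by its expansion. -/
theorem abs_row_sub_le {k₁ k₂ K h P V R L P₀ V₀ R₀ L₀ : ℝ} (hk₁ : 0 ≤ k₁) (hk₂ : 0 ≤ k₂)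
    (hP : |P - P₀| ≤ K * h ^ 3) (hV : |V - V₀| ≤ K * h ^ 3) (hR : |R - R₀| ≤ K * h ^ 3)
    (hL : |L - L₀| ≤ K * h) :
    |(-k₁ * (P - V) - k₂ * (R - V) + h ^ 2 * (k₁ * L))
      - (-k₁ * (P₀ - V₀) - k₂ * (R₀ - V₀) + h ^ 2 * (k₁ * L₀))| ≤ (3 * k₁ + 2 * k₂) * K * h ^ 3 := by
  have h2 : 0 ≤ h ^ 2 * k₁ := by positivity
  rw [abs_le] at *
  have a1 := mul_le_mul_of_nonneg_left hP.1 hk₁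
  have a2 := mul_le_mul_of_nonneg_left hP.2 hk₁
  have a3 := mul_le_mul_of_nonneg_left hV.1 hk₁
  have a4 := mul_le_mul_of_nonneg_left hV.2 hk₁
  have b1 := mul_le_mul_of_nonneg_left hR.1 hk₂
  have b2 := mul_le_mul_of_nonneg_left hR.2 hk₂
  have b3 := mul_le_mul_of_nonneg_left hV.1 hk₂
  have b4 := mul_le_mul_of_nonneg_left hV.2 hk₂
  have c1 := mul_le_mul_of_nonneg_left hL.1 h2
  have c2 := mul_le_mul_of_nonneg_left hL.2 h2
  constructor <;> linarith

/-! ### The defect of the scheme -/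

theorem natCast_pred_mul {i : ℕ} (hi : 1 ≤ i) (h : ℝ) : ((i - 1 : ℕ) : ℝ) * h = i * h - h := by
  push_cast [Nat.cast_sub hi]; ring

theorem natCast_succ_mul (i : ℕ) (h : ℝ) : ((i + 1 : ℕ) : ℝ) * h = i * h + h := by
  push_cast; ring

theorem natCast_mul_meshH_mem_Icc {M j : ℕ} (hj : j ≤ meshN M) :
    (j : ℝ) * meshH M ∈ Icc (0 : ℝ) 1 := by
  have hh := meshH_pos M
  refine ⟨by positivity, ?_⟩
  rw [← meshN_mul_meshH M]
  have : (j : ℝ) ≤ meshN M := by exact_mod_cast hj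
  gcongr

/-- An interior mesh line with its two neighbours. -/
theorem natCast_mul_meshH_mem {M j : ℕ} (h1 : 1 ≤ j) (h2 : j ≤ meshN M - 1) :
    (j : ℝ) * meshH M ∈ Ioo (0 : ℝ) 1 ∧ (j : ℝ) * meshH M - meshH M ∈ Icc (0 : ℝ) 1 ∧
      (j : ℝ) * meshH M + meshH M ∈ Icc (0 : ℝ) 1 := by
  have hh := meshH_pos M
  have hm := natCast_mul_meshH_mem_Icc (M := M) (j := j - 1) (by omega)
  have hp := natCast_mul_meshH_mem_Icc (M := M) (j := j + 1) (by omega)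
  rw [natCast_pred_mul h1] at hm
  rw [natCast_succ_mul] at hp
  exact ⟨⟨by linarith [hm.1], by linarith [hp.2]⟩, hm, hp⟩

section
variable {κm κs : ℝ} {f u : ℝ × ℝ → ℝ}

/-- The error at the nodes. -/
noncomputable def gridError (u : ℝ × ℝ → ℝ) (M : ℕ) (U : ℕ → ℕ → ℝ) (i j : ℕ) : ℝ :=
  u (node M i j) - U i j

theorem gridError_boundary (hu : SolvesInterfaceProblem κm f u) {M : ℕ} {U : ℕ → ℕ → ℝ}
    (hU : SolvesScheme κm κs f M U) {i j : ℕ} (hi : i ≤ meshN M) (hj : j ≤ meshN M)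
    (h : i = 0 ∨ i = meshN M ∨ j = 0 ∨ j = meshN M) : gridError u M U i j = 0 := by
  have h1 : u (node M i j) = 0 := by
    refine hu.boundary _ (mem_frontier_Omega (natCast_mul_meshH_mem_Icc hi)
      (natCast_mul_meshH_mem_Icc hj) ?_)
    rcases h with h | h | h | h <;> simp only [node, h, meshN_mul_meshH] <;> simp
  have h2 : U i j = 0 := by
    rcases h with h | h | h | h
    · rw [h]; exact (hU.bdry_x j hj).1
    · rw [h]; exact (hU.bdry_x j hj).2
    · rw [h]; exact (hU.bdry_y i hi).1
    · rw [h]; exact (hU.bdry_y i hi).2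
  rw [gridError, h1, h2, sub_zero]

theorem Lh_gridError {M : ℕ} {U : ℕ → ℕ → ℝ}
    (hU : SolvesScheme κm κs f M U) {i j : ℕ} (h1 : 1 ≤ i) (h2 : i ≤ meshN M - 1) (h3 : 1 ≤ j)
    (h4 : j ≤ meshN M - 1) : Lh κm κs M (gridError u M U) i j
      = Lh κm κs M (fun i j => u (node M i j)) i j - meshH M ^ 2 * f (node M i j) := by
  rw [← hU.interior i j h1 h2 h3 h4, ← Lh_sub]
  rfl

/-- Away from the interface the defect is of fourth order. -/
theorem exists_defect_away_le (hκm : 0 ≤ κm) (hu : SolvesInterfaceProblem κm f u) (hW : MemW u) :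
    ∃ K : ℝ, 0 ≤ K ∧ ∀ (M : ℕ) (U : ℕ → ℕ → ℝ), SolvesScheme κm κs f M U → ∀ i j : ℕ, 1 ≤ i →
      i ≤ meshN M - 1 → 1 ≤ j → j ≤ meshN M - 1 → i ≠ M → i ≠ M + 1 →
      |Lh κm κs M (gridError u M U) i j| ≤ K * meshH M ^ 4 := by
  have v1 : ContDiffOn ℝ 6 u (strip 0 (1 / 2)) := closure_D1 ▸ hW.1
  have v2 : ContDiffOn ℝ 6 u (strip (1 / 2) 1) := closure_D2 ▸ hW.2
  obtain ⟨K₁, h₁, hK₁⟩ := exists_cross_stencil_le one_half_pos (v1.of_le (by norm_num))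
  obtain ⟨K₂, h₂, hK₂⟩ := exists_cross_stencil_le one_half_lt_one (v2.of_le (by norm_num))
  refine ⟨κm * K₁ + K₂, by positivity, fun M U hU i j i1 i2 j1 j2 hne hne' => ?_⟩
  have hh := meshH_pos M
  have hMh := mul_meshH M
  obtain ⟨hy, hym, hyp⟩ := natCast_mul_meshH_mem j1 j2
  obtain ⟨hx, hxm, hxp⟩ := natCast_mul_meshH_mem i1 i2
  have g1 : 0 ≤ κm * K₁ * meshH M ^ 4 := by positivity
  have g2 : 0 ≤ K₂ * meshH M ^ 4 := by positivity
  rw [Lh_gridError hU i1 i2 j1 j2]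
  rcases lt_or_gt_of_ne hne with h | h
  · have hle : ((i : ℝ) + 1) * meshH M ≤ M * meshH M := by
      gcongr
      exact_mod_cast h
    have hx2 : (i : ℝ) * meshH M + meshH M ≤ 1 / 2 := by linarith
    have e := hK₁ (i * meshH M) (j * meshH M) (meshH M)
      ⟨⟨hx.1.le, by linarith⟩, Ioo_subset_Icc_self hy⟩ ⟨⟨hxm.1, by linarith⟩, hym⟩
      ⟨⟨hxp.1, hx2⟩, hyp⟩
    rw [Lh_of_lt _ _ h]
    simp only [node, natCast_pred_mul i1, natCast_pred_mul j1, natCast_succ_mul]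
    rw [source_left hu hW ⟨hx.1, by linarith⟩ hy]
    rw [abs_le] at *
    have e1 := mul_le_mul_of_nonneg_left e.1 hκm
    have e2 := mul_le_mul_of_nonneg_left e.2 hκm
    constructor <;> linarith
  · have hge : ((M : ℝ) + 1 + 1) * meshH M ≤ i * meshH M := by
      gcongr
      exact_mod_cast (by omega : M + 1 + 1 ≤ i)
    have hx2 : 1 / 2 ≤ (i : ℝ) * meshH M - meshH M := by linarith
    have e := hK₂ (i * meshH M) (j * meshH M) (meshH M)
      ⟨⟨by linarith, hx.2.le⟩, Ioo_subset_Icc_self hy⟩ ⟨⟨hx2, hxm.2⟩, hym⟩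
      ⟨⟨by linarith, hxp.2⟩, hyp⟩
    rw [Lh_of_gt _ _ (by omega)]
    simp only [node, natCast_pred_mul i1, natCast_pred_mul j1, natCast_succ_mul]
    rw [source_right hu hW ⟨by linarith, hx.2⟩ hy]
    rw [abs_le] at *
    constructor <;> linarith

/-- Expansion of the defect on the two mesh lines next to the interface. The terms of order `h`
are opposite to each other; so are, once `∂²u/∂y²` vanishes on the interface, those of order
`h²`. -/
theorem exists_defect_near_le (hκm : 0 ≤ κm) (hκs : 0 ≤ κs)
    (hu : SolvesInterfaceProblem κm f u) (hW : MemW u) :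
    ∃ K : ℝ, 0 ≤ K ∧ ∀ (M : ℕ) (U : ℕ → ℕ → ℝ), 1 ≤ M → SolvesScheme κm κs f M U → ∀ j : ℕ,
      1 ≤ j → j ≤ meshN M - 1 → ∀ p : ℝ × ℝ, p = (1 / 2, (j : ℝ) * meshH M) →
      |Lh κm κs M (gridError u M U) M j
        - (meshH M * (dx 0 (1 / 2) u p * (κm - κs * (1 + κm) / 2)) + meshH M ^ 2 / 4 *
          (2 * κm * dy 0 (1 / 2) (dy 0 (1 / 2) u) p
            - κs * (dx (1 / 2) 1 (dx (1 / 2) 1 u) p - dx 0 (1 / 2) (dx 0 (1 / 2) u) p) / 2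
            - 2 * κs * dy (1 / 2) 1 (dy (1 / 2) 1 u) p))| ≤ K * meshH M ^ 3 ∧
      |Lh κm κs M (gridError u M U) (M + 1) j
        - (-(meshH M * (dx 0 (1 / 2) u p * (κm - κs * (1 + κm) / 2))) + meshH M ^ 2 / 4 *
          (κs * (dx (1 / 2) 1 (dx (1 / 2) 1 u) p - dx 0 (1 / 2) (dx 0 (1 / 2) u) p) / 2
            - 2 * κs * dy 0 (1 / 2) (dy 0 (1 / 2) u) p
            + 2 * dy (1 / 2) 1 (dy (1 / 2) 1 u) p))| ≤ K * meshH M ^ 3 := by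
  have v1 : ContDiffOn ℝ 6 u (strip 0 (1 / 2)) := closure_D1 ▸ hW.1
  have v2 : ContDiffOn ℝ 6 u (strip (1 / 2) 1) := closure_D2 ▸ hW.2
  obtain ⟨K₁, h₁, hK₁⟩ := exists_interface_expansion one_half_pos
    (right_mem_Icc.2 one_half_pos.le) (v1.of_le (by norm_num))
  obtain ⟨K₂, h₂, hK₂⟩ := exists_interface_expansion one_half_lt_one
    (left_mem_Icc.2 one_half_lt_one.le) (v2.of_le (by norm_num))
  refine ⟨(3 * κm + 2 * κs) * (K₁ + K₂) + (3 * 1 + 2 * κs) * (K₁ + K₂), by positivity,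
    fun M U hM hU j j1 j2 p hp => ?_⟩
  subst hp
  have hh := meshH_pos M
  have hMh := mul_meshH M
  have hh3 := meshH_le_third hM
  obtain ⟨hy, hym, hyp⟩ := natCast_mul_meshH_mem j1 j2
  have hy' := Ioo_subset_Icc_self hy
  have hN : M + 1 ≤ meshN M - 1 := by unfold meshN; omega
  have a1 : |-(meshH M / 2)| ≤ 2 * meshH M := by
    rw [abs_neg, abs_of_pos (by positivity)]; linarith
  have a2 : |-(3 * meshH M / 2)| ≤ 2 * meshH M := by
    rw [abs_neg, abs_of_pos (by positivity)]; linarith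
  have a3 : |meshH M / 2| ≤ 2 * meshH M := by
    rw [abs_of_pos (by positivity)]; linarith
  have a4 : |3 * meshH M / 2| ≤ 2 * meshH M := by
    rw [abs_of_pos (by positivity)]; linarith
  have x1 : (M : ℝ) * meshH M = 1 / 2 + -(meshH M / 2) := by linarith
  have x2 : ((M - 1 : ℕ) : ℝ) * meshH M = 1 / 2 + -(3 * meshH M / 2) := by
    rw [natCast_pred_mul hM]; linarith
  have x3 : ((M + 1 : ℕ) : ℝ) * meshH M = 1 / 2 + meshH M / 2 := by
    rw [natCast_succ_mul]; linarith
  have x4 : ((M + 2 : ℕ) : ℝ) * meshH M = 1 / 2 + 3 * meshH M / 2 := by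
    push_cast; linarith
  have l1 := hK₁ (j * meshH M) (meshH M) _ hh.le a1 ⟨by linarith, by linarith⟩ hy' hym hyp
  have l2 := hK₁ (j * meshH M) (meshH M) _ hh.le a2 ⟨by linarith, by linarith⟩ hy' hym hyp
  have l3 := hK₂ (j * meshH M) (meshH M) _ hh.le a3 ⟨by linarith, by linarith⟩ hy' hym hyp
  have l4 := hK₂ (j * meshH M) (meshH M) _ hh.le a4 ⟨by linarith, by linarith⟩ hy' hym hyp
  have hfl := flux_eq hu hW hy
  have w1 : ∀ {t : ℝ} {n : ℕ}, t ≤ K₁ * meshH M ^ n → t ≤ (K₁ + K₂) * meshH M ^ n :=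
    fun ht => ht.trans (mul_le_mul_of_nonneg_right (by linarith) (by positivity))
  have w2 : ∀ {t : ℝ} {n : ℕ}, t ≤ K₂ * meshH M ^ n → t ≤ (K₁ + K₂) * meshH M ^ n :=
    fun ht => ht.trans (mul_le_mul_of_nonneg_right (by linarith) (by positivity))
  have q : 0 ≤ (K₁ + K₂) * meshH M ^ 3 := by positivity
  have q1 : 0 ≤ κm * ((K₁ + K₂) * meshH M ^ 3) := by positivity
  have q2 : 0 ≤ κs * ((K₁ + K₂) * meshH M ^ 3) := by positivity
  constructor
  · have e := abs_row_sub_le hκm hκs (w1 l2.2.1) (w1 l1.1) (w2 l3.2.1)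
      (by simpa using w1 (n := 1) (by simpa using l1.2.2))
    refine (le_of_eq_of_le (congrArg abs ?_) e).trans (by linarith)
    rw [Lh_gridError hU hM (by omega) j1 j2, Lh_left]
    simp only [node, natCast_pred_mul j1, natCast_succ_mul j, x1, x2, x3]
    rw [source_left hu hW ⟨by linarith, by linarith⟩ hy, hfl]
    -- after the flux condition both sides agree as polynomials in the traces
    simp only [lap]
    ring_nf
  · have e := abs_row_sub_le zero_le_one hκs (w2 l4.2.1) (w2 l3.1) (w1 l1.2.1)
      (by simpa using w2 (n := 1) (by simpa using l3.2.2))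
    refine (le_of_eq_of_le (congrArg abs ?_) e).trans (by linarith)
    rw [Lh_gridError hU (by omega) hN j1 j2, Lh_right]
    simp only [node, natCast_pred_mul j1, natCast_succ_mul j, x1, x3, x4]
    rw [source_right hu hW ⟨by linarith, by linarith⟩ hy, hfl]
    -- after the flux condition both sides agree as polynomials in the traces
    simp only [lap]
    ring_nf

theorem norm_errorVec_le {M : ℕ} {U : ℕ → ℕ → ℝ} {Q : ℝ} (hQ : 0 ≤ Q)
    (h : ∀ i j : ℕ, i ≤ meshN M → j ≤ meshN M → |gridError u M U i j| ≤ Q) :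
    ‖errorVec u M U‖ ≤ Q :=
  (pi_norm_le_iff_of_nonneg hQ).2 fun p =>
    h p.1 p.2 (Nat.lt_succ_iff.1 p.1.2) (Nat.lt_succ_iff.1 p.2.2)

end

/-! ### Convergence -/

/-- If the defect next to the interface is a dipole of density `h ^ p * g`, up to one more power
of `h`, then the scheme converges at the rate `h ^ p`. -/
theorem exists_norm_errorVec_le {κm κs : ℝ} {f u : ℝ × ℝ → ℝ} (hκm : 1 ≤ κm) (hκs : 0 < κs)
    (hu : SolvesInterfaceProblem κm f u) (hW : MemW u) {p : ℕ} (hp : p ≤ 2) (g : ℝ → ℝ)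
    (hg0 : g 0 = 0) (hg1 : g 1 = 0)
    (hg : ∃ K : ℝ, 0 ≤ K ∧ (∀ y ∈ Icc (0 : ℝ) 1, |g y| ≤ K) ∧
      ∀ y h : ℝ, y ∈ Icc (0 : ℝ) 1 → y - h ∈ Icc (0 : ℝ) 1 → y + h ∈ Icc (0 : ℝ) 1 →
        |g (y - h) + g (y + h) - 2 * g y| ≤ K * h ^ 2)
    (hd : ∃ K : ℝ, 0 ≤ K ∧ ∀ (M : ℕ) (U : ℕ → ℕ → ℝ), 1 ≤ M → SolvesScheme κm κs f M U → ∀ j : ℕ,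
      1 ≤ j → j ≤ meshN M - 1 →
      |Lh κm κs M (gridError u M U) M j + κs * (meshH M ^ p * g (j * meshH M))|
        ≤ K * meshH M ^ (p + 1) ∧
      |Lh κm κs M (gridError u M U) (M + 1) j - κs * (meshH M ^ p * g (j * meshH M))|
        ≤ K * meshH M ^ (p + 1)) :
    ∃ C : ℝ, 0 < C ∧ ∀ (M : ℕ) (U : ℕ → ℕ → ℝ), 1 ≤ M → SolvesScheme κm κs f M U →
      ‖errorVec u M U‖ ≤ C * (meshH M ^ p * |Real.log (meshH M)|) := by
  obtain ⟨K₁, h₁, hK₁, hK₁'⟩ := hg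
  obtain ⟨K₂, h₂, hK₂⟩ := hd
  obtain ⟨K₃, h₃, hK₃⟩ := exists_defect_away_le (κs := κs) (by linarith) hu hW
  refine ⟨(3 * (κs + 6) + 1) * (K₁ + K₂ + K₃ + 1), by positivity, fun M U hM hU => ?_⟩
  have hh := meshH_pos M
  have hh1 : meshH M ≤ 1 := (meshH_le_third hM).trans (by norm_num)
  have hq : 0 < meshH M ^ p := pow_pos hh p
  have key : ‖errorVec u M U‖ ≤ (3 * (κs + 6) + 1) * ((K₁ + K₂ + K₃ + 1) * meshH M ^ p) := by
    refine norm_errorVec_le (by positivity) fun i j hi hj => ?_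
    refine abs_le_of_dipole hκm hκs hM (G := fun j => meshH M ^ p * g (j * meshH M))
      (by positivity) (fun i j h1 h2 h3 => gridError_boundary hu hU h1 h2 h3)
      (fun j h1 => ?_) (by simp [hg0]) (by simp [meshN_mul_meshH, hg1]) (fun j h1 h2 => ?_)
      (fun i j i1 i2 j1 j2 h1 h2 => ?_) (fun j j1 j2 => ?_) (fun j j1 j2 => ?_) hi hj
    · rw [abs_mul, abs_of_pos hq, mul_comm]
      gcongr
      exact (hK₁ _ (natCast_mul_meshH_mem_Icc h1)).trans (by linarith)
    · obtain ⟨hy, hm, hp⟩ := natCast_mul_meshH_mem h1 h2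
      have e := hK₁' _ _ (Ioo_subset_Icc_self hy) hm hp
      rw [natCast_pred_mul h1, natCast_succ_mul, ← mul_add, mul_left_comm, ← mul_sub, abs_mul,
        abs_of_pos hq, mul_comm (_ + 1) (meshH M ^ p), mul_assoc]
      gcongr
      exact e.trans (mul_le_mul_of_nonneg_right (by linarith) (by positivity))
    · refine (hK₃ M U hU i j i1 i2 j1 j2 h1 h2).trans ?_
      have h22 : meshH M ^ 2 ≤ meshH M ^ p := pow_le_pow_of_le_one hh.le hh1 hp
      calc K₃ * meshH M ^ 4 = K₃ * meshH M ^ 2 * meshH M ^ 2 := by ring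
        _ ≤ (K₁ + K₂ + K₃ + 1) * meshH M ^ p * meshH M ^ 2 := by gcongr; linarith
    · refine (hK₂ M U hM hU j j1 j2).1.trans ?_
      rw [pow_succ, ← mul_assoc]
      gcongr
      linarith
    · refine (hK₂ M U hM hU j j1 j2).2.trans ?_
      rw [pow_succ, ← mul_assoc]
      gcongr
      linarith
  refine key.trans ?_
  rw [← mul_assoc]
  gcongr
  exact le_mul_of_one_le_right hq.le (one_le_abs_log_meshH hM)

section
variable {κm κs : ℝ} {f u : ℝ × ℝ → ℝ}

theorem eq_zero_of_horizontal_edge (hu : SolvesInterfaceProblem κm f u) {x y : ℝ}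
    (hx : x ∈ Icc (0 : ℝ) 1) (hy : y = 0 ∨ y = 1) : u (x, y) = 0 :=
  hu.boundary _ (mem_frontier_Omega hx (by rcases hy with h | h <;> simp [h]) (by tauto))

/-- First-order convergence for an arbitrary averaged coefficient. -/
theorem exists_norm_errorVec_le_order_one (hκm : 1 ≤ κm) (hκs : 0 < κs)
    (hu : SolvesInterfaceProblem κm f u) (hW : MemW u) :
    ∃ C : ℝ, 0 < C ∧ ∀ (M : ℕ) (U : ℕ → ℕ → ℝ), 1 ≤ M → SolvesScheme κm κs f M U →
      ‖errorVec u M U‖ ≤ C * (meshH M ^ 1 * |Real.log (meshH M)|) := by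
  have hR₁ := strip_uniqueDiffOn (one_half_pos (α := ℝ))
  have hR₂ := strip_uniqueDiffOn (one_half_lt_one (α := ℝ))
  have v1 : ContDiffOn ℝ 6 u (strip 0 (1 / 2)) := closure_D1 ▸ hW.1
  have v2 : ContDiffOn ℝ 6 u (strip (1 / 2) 1) := closure_D2 ▸ hW.2
  have hmem₁ : (1 / 2 : ℝ) ∈ Icc (0 : ℝ) (1 / 2) := by norm_num
  have hmem₂ : (1 / 2 : ℝ) ∈ Icc (1 / 2 : ℝ) 1 := by norm_num
  have hκ0 : 0 ≤ κm := by linarith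
  set θ : ℝ := κm - κs * (1 + κm) / 2
  have hedge : ∀ y : ℝ, y = 0 ∨ y = 1 → dx 0 (1 / 2) u (1 / 2, y) = 0 := fun y hy =>
    dx_eq_zero_of_edge one_half_pos (v1.differentiableOn (by norm_num))
      (by rcases hy with h | h <;> simp [h])
      (fun s hs => eq_zero_of_horizontal_edge hu ⟨hs.1, by linarith [hs.2]⟩ hy) hmem₁
  refine exists_norm_errorVec_le hκm hκs hu hW one_le_two
    (fun y => -(θ / κs) * dx 0 (1 / 2) u (1 / 2, y)) (by rw [hedge 0 (Or.inl rfl), mul_zero])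
    (by rw [hedge 1 (Or.inr rfl), mul_zero]) ?_ ?_
  · obtain ⟨K, h0, hK, hK'⟩ := exists_vertical_second_difference_le one_half_pos hmem₁
      (dirDeriv_contDiffOn hR₁ (n := 2) (v1.of_le (by norm_num)) (1, 0))
    refine ⟨|-(θ / κs)| * K, by positivity, fun y hy => ?_, fun y h hy hm hp => ?_⟩
    · rw [abs_mul]
      exact mul_le_mul_of_nonneg_left (hK y hy) (abs_nonneg _)
    · rw [← mul_add, mul_left_comm, ← mul_sub, abs_mul, mul_assoc]
      exact mul_le_mul_of_nonneg_left (hK' y h hy hm hp) (abs_nonneg _)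
  · obtain ⟨K, h0, hK⟩ := exists_defect_near_le hκ0 hκs.le hu hW
    obtain ⟨A₁, hA₁, A₁'⟩ := exists_abs_le (strip_compact _ _)
      (dirDeriv_iterate_contDiffOn hR₁ (1, 0) 0 2 (v1.of_le (by norm_num))).continuousOn
    obtain ⟨A₂, hA₂, A₂'⟩ := exists_abs_le (strip_compact _ _)
      (dirDeriv_iterate_contDiffOn hR₂ (1, 0) 0 2 (v2.of_le (by norm_num))).continuousOn
    obtain ⟨B₁, hB₁, B₁'⟩ := exists_abs_le (strip_compact _ _)
      (dirDeriv_iterate_contDiffOn hR₁ (0, 1) 0 2 (v1.of_le (by norm_num))).continuousOn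
    obtain ⟨B₂, hB₂, B₂'⟩ := exists_abs_le (strip_compact _ _)
      (dirDeriv_iterate_contDiffOn hR₂ (0, 1) 0 2 (v2.of_le (by norm_num))).continuousOn
    refine ⟨K + (2 * κm * B₁ + κs * (A₂ + A₁) / 2 + 2 * κs * B₂ + 2 * κs * B₁ + 2 * B₂),
      by positivity, fun M U hM hU j j1 j2 => ?_⟩
    have hh := meshH_pos M
    have hh1 : meshH M ≤ 1 := (meshH_le_third hM).trans (by norm_num)
    have hy := Ioo_subset_Icc_self (natCast_mul_meshH_mem j1 j2).1
    obtain ⟨e1, e2⟩ := hK M U hM hU j j1 j2 _ rfl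
    have a1 := abs_le.1 (A₁' (1 / 2, j * meshH M) ⟨hmem₁, hy⟩)
    have a2 := abs_le.1 (A₂' (1 / 2, j * meshH M) ⟨hmem₂, hy⟩)
    have b1 := abs_le.1 (B₁' (1 / 2, j * meshH M) ⟨hmem₁, hy⟩)
    have b2 := abs_le.1 (B₂' (1 / 2, j * meshH M) ⟨hmem₂, hy⟩)
    simp only [Function.iterate_succ_apply', Function.iterate_zero_apply] at a1 a2 b1 b2
    have h2 : 0 ≤ meshH M ^ 2 := by positivity
    have hK3 : K * meshH M ^ 3 ≤ K * meshH M ^ 2 :=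
      mul_le_mul_of_nonneg_left (pow_le_pow_of_le_one hh.le hh1 (by norm_num)) h0
    have hcancel : ∀ t : ℝ, κs * (meshH M ^ 1 * (-(θ / κs) * t)) = -(meshH M * (t * θ)) := by
      intro t
      field_simp
    rw [hcancel]
    -- a defect bracket of size `S` enters with the factor `h ^ 2 / 4`
    have hfin : ∀ {L T R S : ℝ}, |L - (T + meshH M ^ 2 / 4 * R)| ≤ K * meshH M ^ 3 → |R| ≤ S →
        |L - T| ≤ (K + S) * meshH M ^ 2 := by
      intro L T R S hL hRS
      have h3 : |meshH M ^ 2 / 4 * R| ≤ meshH M ^ 2 * S := by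
        rw [abs_mul, abs_of_nonneg (by positivity)]
        have := (abs_nonneg R).trans hRS
        calc _ ≤ meshH M ^ 2 / 4 * S := by gcongr
          _ ≤ meshH M ^ 2 * S := by nlinarith [mul_nonneg h2 this]
      rw [abs_le] at *
      constructor <;> linarith
    have m1 := mul_le_mul_of_nonneg_left b1.1 hκ0
    have m2 := mul_le_mul_of_nonneg_left b1.2 hκ0
    have m3 := mul_le_mul_of_nonneg_left b1.1 hκs.le
    have m4 := mul_le_mul_of_nonneg_left b1.2 hκs.le
    have m5 := mul_le_mul_of_nonneg_left b2.1 hκs.le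
    have m6 := mul_le_mul_of_nonneg_left b2.2 hκs.le
    have m7 := mul_le_mul_of_nonneg_left a1.1 hκs.le
    have m8 := mul_le_mul_of_nonneg_left a1.2 hκs.le
    have m9 := mul_le_mul_of_nonneg_left a2.1 hκs.le
    have m10 := mul_le_mul_of_nonneg_left a2.2 hκs.le
    have n1 : 0 ≤ κm * B₁ := by positivity
    have n2 : 0 ≤ κs * B₁ := by positivity
    have n3 : 0 ≤ κs * B₂ := by positivity
    constructor
    · rw [← sub_eq_add_neg]
      exact hfin e1 (abs_le.2 ⟨by linarith, by linarith⟩)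
    · exact hfin e2 (abs_le.2 ⟨by linarith, by linarith⟩)

/-- Under Assumption I the second `y`-derivatives from both sides vanish on the interface. -/
theorem dy_dy_eq_zero (hW : MemW u) (hA : AssumptionI κm κs u) {y : ℝ} (hy : y ∈ Ioo (0 : ℝ) 1) :
    dy 0 (1 / 2) (dy 0 (1 / 2) u) (1 / 2, y) = 0 ∧
      dy (1 / 2) 1 (dy (1 / 2) 1 u) (1 / 2, y) = 0 := by
  have hR₁ := strip_uniqueDiffOn (one_half_pos (α := ℝ))
  have hR₂ := strip_uniqueDiffOn (one_half_lt_one (α := ℝ))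
  have v1 : ContDiffOn ℝ 6 u (strip 0 (1 / 2)) := closure_D1 ▸ hW.1
  have v2 : ContDiffOn ℝ 6 u (strip (1 / 2) 1) := closure_D2 ▸ hW.2
  have d1 := dirDeriv_contDiffOn hR₁ (n := 2) (v1.of_le (by norm_num)) (0, 1)
  have d2 := dirDeriv_contDiffOn hR₂ (n := 2) (v2.of_le (by norm_num)) (0, 1)
  have hy' := Ioo_subset_Icc_self hy
  constructor
  · have e : (fun x => pdy (pdy u) (x, y)) =ᶠ[𝓝[<] (1 / 2)]
        fun x => dy 0 (1 / 2) (dy 0 (1 / 2) u) (x, y) := by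
      filter_upwards [Ioo_mem_nhdsLT (one_half_pos : (0 : ℝ) < 1 / 2)] with x hx
      exact pdy_pdy_eq (v1.differentiableOn (by norm_num)) (d1.differentiableOn (by norm_num)) hx hy
    exact tendsto_nhds_unique (tendsto_trace_left one_half_pos
      (dirDeriv_contDiffOn hR₁ (n := 1) d1 (0, 1)).continuousOn hy') ((hA.left y hy).congr' e)
  · have e : (fun x => pdy (pdy u) (x, y)) =ᶠ[𝓝[>] (1 / 2)]
        fun x => dy (1 / 2) 1 (dy (1 / 2) 1 u) (x, y) := by
      filter_upwards [Ioo_mem_nhdsGT (one_half_lt_one : (1 / 2 : ℝ) < 1)] with x hx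
      exact pdy_pdy_eq (v2.differentiableOn (by norm_num)) (d2.differentiableOn (by norm_num)) hx hy
    exact tendsto_nhds_unique (tendsto_trace_right one_half_lt_one
      (dirDeriv_contDiffOn hR₂ (n := 1) d2 (0, 1)).continuousOn hy') ((hA.right y hy).congr' e)

/-- Second-order convergence under Assumption I: harmonic averaging cancels the dipole of order
`h`, and the one of order `h ^ 2` has the jump of `∂²u/∂x²` as its density. -/
theorem exists_norm_errorVec_le_order_two (hκm : 1 ≤ κm) (hκs : 0 < κs)
    (hu : SolvesInterfaceProblem κm f u) (hW : MemW u) (hA : AssumptionI κm κs u) :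
    ∃ C : ℝ, 0 < C ∧ ∀ (M : ℕ) (U : ℕ → ℕ → ℝ), 1 ≤ M → SolvesScheme κm κs f M U →
      ‖errorVec u M U‖ ≤ C * (meshH M ^ 2 * |Real.log (meshH M)|) := by
  have hR₁ := strip_uniqueDiffOn (one_half_pos (α := ℝ))
  have hR₂ := strip_uniqueDiffOn (one_half_lt_one (α := ℝ))
  have v1 : ContDiffOn ℝ 6 u (strip 0 (1 / 2)) := closure_D1 ▸ hW.1
  have v2 : ContDiffOn ℝ 6 u (strip (1 / 2) 1) := closure_D2 ▸ hW.2
  have d1 := dirDeriv_contDiffOn hR₁ (n := 3) (v1.of_le (by norm_num)) (1, 0)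
  have d2 := dirDeriv_contDiffOn hR₂ (n := 3) (v2.of_le (by norm_num)) (1, 0)
  have hmem₁ : (1 / 2 : ℝ) ∈ Icc (0 : ℝ) (1 / 2) := by norm_num
  have hmem₂ : (1 / 2 : ℝ) ∈ Icc (1 / 2 : ℝ) 1 := by norm_num
  have hκ0 : 0 ≤ κm := by linarith
  have hθ : κm - κs * (1 + κm) / 2 = 0 := by
    have : κm + 1 ≠ 0 := by positivity
    rw [hA.harmonic]
    field_simp
    ring
  have hedge : ∀ y : ℝ, y = 0 ∨ y = 1 → dx 0 (1 / 2) (dx 0 (1 / 2) u) (1 / 2, y) = 0 ∧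
      dx (1 / 2) 1 (dx (1 / 2) 1 u) (1 / 2, y) = 0 := by
    intro y hy
    have hy' : y ∈ Icc (0 : ℝ) 1 := by rcases hy with h | h <;> simp [h]
    refine ⟨dx_eq_zero_of_edge one_half_pos (d1.differentiableOn (by norm_num)) hy'
      (fun x hx => dx_eq_zero_of_edge one_half_pos (v1.differentiableOn (by norm_num)) hy'
        (fun s hs => eq_zero_of_horizontal_edge hu ⟨hs.1, by linarith [hs.2]⟩ hy) hx) hmem₁,
      dx_eq_zero_of_edge one_half_lt_one (d2.differentiableOn (by norm_num)) hy'
      (fun x hx => dx_eq_zero_of_edge one_half_lt_one (v2.differentiableOn (by norm_num)) hy'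
        (fun s hs => eq_zero_of_horizontal_edge hu ⟨by linarith [hs.1], hs.2⟩ hy) hx) hmem₂⟩
  refine exists_norm_errorVec_le hκm hκs hu hW le_rfl
    (fun y => (dx (1 / 2) 1 (dx (1 / 2) 1 u) (1 / 2, y)
      - dx 0 (1 / 2) (dx 0 (1 / 2) u) (1 / 2, y)) / 8)
    (by simp only [hedge 0 (Or.inl rfl), sub_zero, zero_div])
    (by simp only [hedge 1 (Or.inr rfl), sub_zero, zero_div]) ?_ ?_
  · obtain ⟨K₁, h₁, hK₁, hK₁'⟩ := exists_vertical_second_difference_le one_half_pos hmem₁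
      (dirDeriv_contDiffOn hR₁ (n := 2) d1 (1, 0))
    obtain ⟨K₂, h₂, hK₂, hK₂'⟩ := exists_vertical_second_difference_le one_half_lt_one hmem₂
      (dirDeriv_contDiffOn hR₂ (n := 2) d2 (1, 0))
    refine ⟨K₁ + K₂, by positivity, fun y hy => ?_, fun y h hy hm hp => ?_⟩
    · have e1 := abs_le.1 (hK₁ y hy)
      have e2 := abs_le.1 (hK₂ y hy)
      rw [abs_le]
      constructor <;> linarith
    · have e1 := abs_le.1 (hK₁' y h hy hm hp)
      have e2 := abs_le.1 (hK₂' y h hy hm hp)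
      have n1 : 0 ≤ K₁ * h ^ 2 := by positivity
      have n2 : 0 ≤ K₂ * h ^ 2 := by positivity
      rw [abs_le]
      constructor <;> linarith
  · obtain ⟨K, h0, hK⟩ := exists_defect_near_le hκ0 hκs.le hu hW
    refine ⟨K, h0, fun M U hM hU j j1 j2 => ?_⟩
    obtain ⟨e1, e2⟩ := hK M U hM hU j j1 j2 _ rfl
    obtain ⟨z1, z2⟩ := dy_dy_eq_zero hW hA (natCast_mul_meshH_mem j1 j2).1
    rw [hθ, z1, z2] at e1 e2
    refine ⟨le_of_eq_of_le (congrArg abs ?_) e1, le_of_eq_of_le (congrArg abs ?_) e2⟩ <;> ring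

end

end MachScheme

theorem mainTheorem1 (κm κs : ℝ) (hκm : 1 ≤ κm) (hκs : 0 < κs) (f u : ℝ × ℝ → ℝ)
    (hu : MachScheme.SolvesInterfaceProblem κm f u) (hW : MachScheme.MemW u) :
    (∃ C : ℝ, 0 < C ∧ ∀ (M : ℕ) (U : ℕ → ℕ → ℝ), 1 ≤ M → MachScheme.SolvesScheme κm κs f M U →
      ‖MachScheme.errorVec u M U‖ ≤ C * (MachScheme.meshH M * |Real.log (MachScheme.meshH M)|)) ∧
    (MachScheme.AssumptionI κm κs u →
      ∃ C : ℝ, 0 < C ∧ ∀ (M : ℕ) (U : ℕ → ℕ → ℝ), 1 ≤ M → MachScheme.SolvesScheme κm κs f M U →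
        ‖MachScheme.errorVec u M U‖ ≤
          C * (MachScheme.meshH M ^ 2 * |Real.log (MachScheme.meshH M)|)) :=
  ⟨by simpa only [pow_one] using
      MachScheme.exists_norm_errorVec_le_order_one hκm hκs hu hW,
    MachScheme.exists_norm_errorVec_le_order_two hκm hκs hu hW⟩
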